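/- Let $k$ be a field, $G$ a finite group and $M$ a finite dimensional $kG$-module. Conventions. Let $S=\bigoplus_i S_i$ be a commutative $\mathbb Z$-graded $k$-algebra on which $G$ acts by graded $k$-algebra automorphisms, and let $R\le S^G$ be a graded $k$-subalgebra that is graded local, i.e. has a unique maximal homogeneous ideal $\mathfrak m$. Then $\operatorname{Hom}_{kG}(M,S)$ and $\operatorname{Ext}^j_{kG}(M,S)$ are $R$-modules, $r\in R$ acting through multiplication by $r$ on $S$. For an $R$-module $X$, $\operatorname{depth}_R X\in\mathbb N\cup\{\infty\}$ is the least $i$ such that the local cohomology $H^i_{\mathfrak m}(X)=\varinjlim_n\operatorname{Ext}^i_R(R/\mathfrak m^n,X)$ is non-zero, and $\infty$ if there is none; in particular $\operatorname{depth}_R 0=\infty$. **(1)** For all such $S$ and $R$, $$\operatorname{depth}_R \operatorname{Hom}_{kG}(M,S)\ \ge\ \min\Bigl\{\operatorname{depth}_R S,\ \min_{j\ge 1}\bigl(\operatorname{depth}_R \operatorname{Ext}^j_{kG}(M,S)+j+1\bigr)\Bigr\}.$$ **(2)** Let $V$ be a finite dimensional $kG$-module and let $k[V]$ be the symmetric algebra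 of $V^*$, with $V^*$ in degree $1$. Let $P\le G$ be a subgroup such that $M$ is relatively $P$-projective (for example $P=G$, or a Sylow $p$-subgroup of $G$ if $p=\operatorname{char}k>0$, or a vertex of $M$ if $M$ is indecomposable). Put $n=\dim_k V$ and $m=\dim_k V^P$. Let $y_1,\dots,y_m\in k[V]^P$ be homogeneous elements such that $k[V^P]$ is finite over $k[y_1,\dots,y_m]$, let $z_{m+1},\dots,z_n\in k[V]^P$ be homogeneous, and let $U\subseteq k[V]$ be a $k[z_{m+1},\dots,z_n]P$-submodule, finite over $k[z_{m+1},\dots,z_n]$, such that multiplication $k[y_1,\dots,y_m]\otimes_k U\to k[V]$ is an isomorphism. Then for every graded $k$-subalgebra $R\le k[V]^G$ over which $k[V]$ is finite, $$\operatorname{depth}_R \operatorname{Hom}_{kG}(M,k[V])\ \ge\ \min\Bigl\{\dim_k V,\ \dim_k V^P+\min_{j\ge 1}\bigl(\operatorname{depth}\operatorname{Ext}^j_{kP}(M,U)+j+1\bigr)\Bigr\},$$ where the depth on the right is taken over $k[z_{m+1},\dots,z_n]$. (For $P=G$ the groups on the right are $\operatorname{Ext}^j_{kG}(M,U)$.)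 -/

import Mathlib

universe u

noncomputable section

open CategoryTheory

section RGModules

variable (k : Type u) [Field k] {A : Type u} [CommRing A] [Algebra k A]
  {G : Type u} [Group G] {X : Type u} [AddCommGroup X] [Module k X] [Module A X]
  [IsScalarTower k A X]

/-- An `A`-linear representation of `G` (an `AG`-module), regarded as a `k`-linear one. -/
def restrictRep (ρ : Representation A G X) : Representation k G X where
  toFun g := (ρ g).restrictScalars k
  map_one' := by ext x; simp
  map_mul' g h := by ext x; simp

/-- An `AG`-module as an object of the category of `kG`-modules. -/
abbrev kGModule (ρ : Representation A G X) : ModuleCat.{u} (MonoidAlgebra k G) :=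
  ModuleCat.of (MonoidAlgebra k G) (restrictRep k ρ).asModule

/-- Multiplication by `a : A` on an `AG`-module, as a homomorphism of `kG`-modules. -/
def kGMul (ρ : Representation A G X) (a : A) :
    (restrictRep k ρ).asModule →ₗ[MonoidAlgebra k G] (restrictRep k ρ).asModule :=
  MonoidAlgebra.equivariantOfLinearOfComm
    ((restrictRep k ρ).asModuleEquiv.symm.toLinearMap ∘ₗ
      ((LinearMap.lsmul A X a).restrictScalars k) ∘ₗ
      (restrictRep k ρ).asModuleEquiv.toLinearMap)
    (fun g v => by
      rw [Representation.single_smul, Representation.single_smul, one_smul, one_smul]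
      exact ((ρ g).map_smul a ((restrictRep k ρ).asModuleEquiv v)).symm)

theorem kGMul_apply (ρ : Representation A G X) (a : A) (x : (restrictRep k ρ).asModule) :
    (restrictRep k ρ).asModuleEquiv (kGMul k ρ a x)
      = a • (restrictRep k ρ).asModuleEquiv x := rfl

/-- The action of `A` on an `AG`-module `X` by endomorphisms of the `kG`-module `X`. -/
def kGEnd (ρ : Representation A G X) : A →+* End (kGModule k ρ) where
  toFun a := ModuleCat.ofHom (kGMul k ρ a)
  map_one' := by
    apply ModuleCat.hom_ext; ext x; exact one_smul A ((restrictRep k ρ).asModuleEquiv x)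
  map_zero' := by
    apply ModuleCat.hom_ext; ext x; exact zero_smul A ((restrictRep k ρ).asModuleEquiv x)
  map_add' a b := by
    apply ModuleCat.hom_ext; ext x; exact add_smul a b ((restrictRep k ρ).asModuleEquiv x)
  map_mul' a b := by
    apply ModuleCat.hom_ext; ext x; exact mul_smul a b ((restrictRep k ρ).asModuleEquiv x)

end RGModules

/-- `Ext^n(X, Y)` is a module over the endomorphism ring of `Y`, by functoriality in `Y`
(the analogue for `Ext` of `CategoryTheory.Preadditive.moduleEndRight`). -/
instance extModuleEnd {C : Type*} [Category C] [Abelian C] [HasExt.{u} C] (X Y : C) (n : ℕ) :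
    Module (End Y) (Abelian.Ext X Y n) where
  smul f e := e.comp (Abelian.Ext.mk₀ f) (add_zero n)
  one_smul e := Abelian.Ext.comp_mk₀_id e
  mul_smul f g e := by
    change e.comp (Abelian.Ext.mk₀ (g ≫ f)) _
      = (e.comp (Abelian.Ext.mk₀ g) _).comp (Abelian.Ext.mk₀ f) _
    rw [Abelian.Ext.comp_assoc_of_third_deg_zero, Abelian.Ext.mk₀_comp_mk₀]
  smul_zero f := Abelian.Ext.zero_comp ..
  smul_add f e e' := Abelian.Ext.add_comp ..
  add_smul f g e := by
    change e.comp (Abelian.Ext.mk₀ (f + g)) _ = e.comp _ _ + e.comp _ _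
    rw [Abelian.Ext.mk₀_add, Abelian.Ext.comp_add]
  zero_smul e := by
    change e.comp (Abelian.Ext.mk₀ (0 : Y ⟶ Y)) _ = 0
    rw [Abelian.Ext.mk₀_zero, Abelian.Ext.comp_zero]

section HomExt

variable {k : Type u} [Field k] {A : Type u} [CommRing A] [Algebra k A]
  {G : Type u} [Group G] {M : Type u} [AddCommGroup M] [Module k M]
  {X : Type u} [AddCommGroup X] [Module k X] [Module A X] [IsScalarTower k A X]

/-- `Hom_{kG}(M, X)` as an `A`-module, for a `kG`-module `M` and an `AG`-module `X`. -/
def homKG (σ : Representation k G M) (ρ : Representation A G X) : ModuleCat.{u} A :=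
  (ModuleCat.restrictScalars (kGEnd k ρ)).obj
    (ModuleCat.of (End (kGModule k ρ))
      (ModuleCat.of (MonoidAlgebra k G) σ.asModule ⟶ kGModule k ρ))

/-- `Ext^j_{kG}(M, X)` as an `A`-module, for a `kG`-module `M` and an `AG`-module `X`:
`a : A` acts through the endomorphism of the `kG`-module `X` that it induces. -/
def extKG (σ : Representation k G M) (ρ : Representation A G X) (j : ℕ) : ModuleCat.{u} A :=
  (ModuleCat.restrictScalars (kGEnd k ρ)).obj
    (ModuleCat.of (End (kGModule k ρ))
      (Abelian.Ext (ModuleCat.of (MonoidAlgebra k G) σ.asModule) (kGModule k ρ) j))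

/-- `M` is relatively `P`-projective: every epimorphism of `kG`-modules onto `M` that splits
over `P` splits over `G`. -/
def IsRelativelyProjective (σ : Representation k G M) (P : Subgroup G) : Prop :=
  ∀ (Y : Type u) [AddCommGroup Y] [Module k Y] (τ : Representation k G Y) (π : Y →ₗ[k] M),
    (∀ g y, π (τ g y) = σ g (π y)) →
    (∃ s : M →ₗ[k] Y, (∀ h ∈ P, ∀ m, s (σ h m) = τ h (s m)) ∧ π ∘ₗ s = LinearMap.id) →
    ∃ s : M →ₗ[k] Y, (∀ g m, s (σ g m) = τ g (s m)) ∧ π ∘ₗ s = LinearMap.id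

end HomExt

section Depth

/-- The depth of an `A`-module with respect to an ideal `I`: the least `i` such that the local
cohomology `H^i_I(X)` is non-zero. It is `⊤` if there is no such `i`, e.g. if `X = 0`. -/
def depthAt {A : Type u} [CommRing A] (I : Ideal A) (X : ModuleCat.{u} A) : ℕ∞ :=
  ⨅ (i : ℕ) (_ : ¬ Limits.IsZero ((localCohomology I i).obj X)), (i : ℕ∞)

variable {k : Type u} [Field k] {S : Type u} [CommRing S] [Algebra k S] {ι : Type}

/-- A graded subalgebra of `S = ⨁ 𝒜 i`: one that is the sum of its homogeneous parts. -/
def IsGradedSubalgebra (𝒜 : ι → Submodule k S) (R : Subalgebra k S) : Prop :=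
  Subalgebra.toSubmodule R = ⨆ i, Subalgebra.toSubmodule R ⊓ 𝒜 i

/-- A homogeneous ideal of a graded subalgebra `R` of `S`: one generated by homogeneous
elements. -/
def IsHomogeneousIdeal (𝒜 : ι → Submodule k S) (R : Subalgebra k S) (I : Ideal R) : Prop :=
  I = Ideal.span {r : R | r ∈ I ∧ ∃ i, (r : S) ∈ 𝒜 i}

/-- The sum of all the proper homogeneous ideals of `R`. If `R` is graded local then this is its
unique maximal homogeneous ideal. -/
def gradedMaximalIdeal (𝒜 : ι → Submodule k S) (R : Subalgebra k S) : Ideal R :=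
  sSup {I : Ideal R | I ≠ ⊤ ∧ IsHomogeneousIdeal 𝒜 R I}

/-- `R` is graded local: it has a largest proper homogeneous ideal (equivalently, exactly one
maximal homogeneous ideal). -/
def IsGradedLocal (𝒜 : ι → Submodule k S) (R : Subalgebra k S) : Prop :=
  gradedMaximalIdeal 𝒜 R ≠ ⊤

/-- `depth_R X` for a module `X` over a graded local subalgebra `R` of `S`. -/
def gradedDepth (𝒜 : ι → Submodule k S) (R : Subalgebra k S) (X : ModuleCat.{u} R) : ℕ∞ :=
  depthAt (gradedMaximalIdeal 𝒜 R) X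

/-- If `G` acts on the `k`-algebra `S` and fixes the elements of the subalgebra `R`, then `S` is
an `RG`-module. -/
def invRep {G : Type u} [Group G] (α : G →* (S →ₐ[k] S)) (R : Subalgebra k S)
    (hR : ∀ g, ∀ r ∈ R, α g r = r) : Representation R G S where
  toFun g :=
    { toFun := α g
      map_add' := map_add (α g)
      map_smul' := fun r x => by
        change α g ((r : S) * x) = (r : S) * α g x
        rw [map_mul, hR g r r.2] }
  map_one' := by ext x; simp
  map_mul' g h := by ext x; simp

/-- An `RG`-submodule of `S` as an `RG`-module. -/
def invSubRep {G : Type u} [Group G] (α : G →* (S →ₐ[k] S)) (R : Subalgebra k S)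
    (hR : ∀ g, ∀ r ∈ R, α g r = r) (U : Submodule R S) (hU : ∀ g, ∀ u ∈ U, α g u ∈ U) :
    Representation R G U where
  toFun g := (invRep α R hR g).restrict (hU g)
  map_one' := by ext x; simp
  map_mul' g h := by
    ext x
    change invRep α R hR (g * h) x = invRep α R hR g (invRep α R hR h x)
    rw [map_mul]; rfl

end Depth

section Polynomial

variable (k : Type u) [Field k] (V : Type u) [AddCommGroup V] [Module k V]

/-- The polynomial ring `k[V]`: the symmetric algebra on the dual of `V`. -/
abbrev PolyRing : Type u := SymmetricAlgebra k (Module.Dual k V)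

/-- The grading of `k[V]`, with `V^*` in degree 1. -/
def polyGrading (d : ℕ) : Submodule k (PolyRing k V) :=
  LinearMap.range (SymmetricAlgebra.ι k (Module.Dual k V)) ^ d

variable {k V}

/-- The restriction map `k[V] → k[W]` for a subspace `W` of `V`. -/
def polyRestrict (W : Submodule k V) : PolyRing k V →ₐ[k] PolyRing k W :=
  SymmetricAlgebra.lift (SymmetricAlgebra.ι k (Module.Dual k W) ∘ₗ W.subtype.dualMap)

variable {G : Type u} [Group G]

/-- The action of `G` on `k[V]` by algebra automorphisms induced by its action on `V^*`. -/
def polyAction (ρ : Representation k G V) : G →* (PolyRing k V →ₐ[k] PolyRing k V) where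
  toFun g := SymmetricAlgebra.lift (SymmetricAlgebra.ι k (Module.Dual k V) ∘ₗ ρ.dual g)
  map_one' := by
    apply SymmetricAlgebra.algHom_ext
    rw [map_one]; ext x; simp
  map_mul' g h := by
    apply SymmetricAlgebra.algHom_ext
    rw [map_mul]; ext x; simp

/-- A splitting `k[y_1, …, y_m] ⊗ U ≅ k[V]` for a `kP`-module `V`, where `n = dim V` and
`m = dim V^P`: homogeneous invariants `y_1, …, y_m` such that `k[V^P]` is finite over
`k[y_1, …, y_m]`, homogeneous invariants `z_{m+1}, …, z_n`, and a
`k[z_{m+1}, …, z_n]P`-submodule `U` of `k[V]`, finite over `k[z_{m+1}, …, z_n]`, such that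
multiplication `k[y_1, …, y_m] ⊗ U → k[V]` is bijective. -/
structure PolySplitting {P : Type u} [Group P] (ρ : Representation k P V) where
  y : Fin (Module.finrank k ρ.invariants) → PolyRing k V
  y_invariant : ∀ g i, polyAction ρ g (y i) = y i
  y_homogeneous : ∀ i, ∃ d, y i ∈ polyGrading k V d
  y_finite : ((polyRestrict ρ.invariants).comp (Algebra.adjoin k (Set.range y)).val).Finite
  z : Fin (Module.finrank k V - Module.finrank k ρ.invariants) → PolyRing k V
  z_invariant : ∀ g i, polyAction ρ g (z i) = z i
  z_homogeneous : ∀ i, ∃ d, z i ∈ polyGrading k V d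
  U : Submodule (Algebra.adjoin k (Set.range z)) (PolyRing k V)
  U_stable : ∀ g, ∀ u ∈ U, polyAction ρ g u ∈ U
  U_finite : Module.Finite (Algebra.adjoin k (Set.range z)) U
  mul_bijective : Function.Bijective
    (Submodule.mulMap (Subalgebra.toSubmodule (Algebra.adjoin k (Set.range y)))
      (U.restrictScalars k))

namespace PolySplitting

variable {P : Type u} [Group P] {ρ : Representation k P V} (D : PolySplitting ρ)

/-- The algebra `k[z_{m+1}, …, z_n]`. -/
abbrev kz : Subalgebra k (PolyRing k V) := Algebra.adjoin k (Set.range D.z)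

theorem kz_invariant (g : P) : ∀ r ∈ D.kz, polyAction ρ g r = r := by
  intro r hr
  have h : D.kz ≤ AlgHom.equalizer (polyAction ρ g) (AlgHom.id k _) :=
    Algebra.adjoin_le (by rintro _ ⟨i, rfl⟩; exact D.z_invariant g i)
  exact h hr

/-- `U` as a `k[z_{m+1}, …, z_n]P`-module. -/
def URep : Representation D.kz P D.U :=
  invSubRep (polyAction ρ) D.kz D.kz_invariant D.U D.U_stable

end PolySplitting

end Polynomial

end

-- Depth is used only in the form `d ≤ depthAt I X`, that is: for each `i < d`, every class in
-- `Ext^i(A/I^n, X)` dies on some `A/I^m`. In this form the long exact sequences can be chased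
-- element by element, without noetherian hypotheses.
--
-- Part (1) is dimension shifting. Take `0 → K → F → M → 0` with `F` free of finite rank over `kG`.
-- Since `Ext^1(F, S) = 0`, the Hom sequence splits into `0 → Hom(M,S) → Hom(F,S) → K' → 0` and `0 →
-- K' → Hom(K,S) → Ext^1(M,S) → 0`. As `Hom(F,S)` is a finite sum of copies of `S`, the depth of
-- `Hom(M,S)` is at least the minimum of `depth S`, `depth Hom(K,S) + 1` and `depth Ext^1(M,S) + 2`.
-- Because `Ext^j(K,S) ≅ Ext^{j+1}(M,S)`, induction on the desired bound, with `K` in place of `M`,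
-- finishes the argument.
--
-- For part (2), Higman's criterion makes `Hom_{kG}(M, k[V])` a retract of `Hom_{kP}(M, k[V])`, so
-- part (1) may be applied to `P`. Two estimates over `R` remain.
--
-- (a) `depth k[V] ≥ n`: the variables form a regular sequence.
--
-- (b) `depth Ext^j_{kP}(M, k[V]) ≥ m + depth Ext^j_{kP}(M, U)`: the isomorphism `k[V] ≅ k[y] ⊗ U`
-- is `P`-equivariant with trivial action on `k[y]`. Division by `y_i`, the projection to `U` and
-- the inclusion of `U` are therefore equivariant maps, and applying `Ext^j` to them shows that the
-- `y_i` form a regular sequence on `Ext^j(M, k[V])` with quotient `Ext^j(M, U)`.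
--
-- Both estimates arise over other rings and are carried to `R` by `depthAt_restrictScalars_le`:
-- depth cannot drop when the finitely generated ideal `I` is replaced by `J` with `I C ⊆ rad(J C)`.
-- Here the radical condition holds because positive-degree homogeneous elements of `k[V]` are
-- integral over `R`, hence nilpotent modulo the graded maximal ideal of `R`.

universe v

noncomputable section

open CategoryTheory Opposite

/-! ### Local cohomology in terms of Yoneda-type Ext groups -/

section Comparison

open Limits Abelian

variable {A : Type u} [CommRing A]

/-- The chain complex `Hom(P, X)` in the opposite category of `A`-modules, for a projective
resolution `P`. -/
abbrev homChainComplex {N : ModuleCat.{u} A} (P : ProjectiveResolution N) (X : ModuleCat.{u} A) :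
    ChainComplex (ModuleCat.{u} A)ᵒᵖ ℕ :=
  (((linearYoneda A (ModuleCat.{u} A)).obj X).rightOp.mapHomologicalComplex _).obj P.complex

/-- `Ext^n(N, X)` computed by the projective resolution `P`. -/
abbrev leftDerivedHomIso {N : ModuleCat.{u} A} (P : ProjectiveResolution N) (X : ModuleCat.{u} A)
    (n : ℕ) : (((linearYoneda A (ModuleCat.{u} A)).obj X).rightOp.leftDerived n).obj N ≅
      (homChainComplex P X).homology n :=
  P.isoLeftDerivedObj ((linearYoneda A (ModuleCat.{u} A)).obj X).rightOp n

/-- The cocycle `f : P_n ⟶ X` represents the class `x` in `Ext^n(N, X)`, where the latter is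
defined by left derived functors. -/
def Represents {N X : ModuleCat.{u} A} (P : ProjectiveResolution N) {n : ℕ}
    (f : P.complex.X n ⟶ X) (x : ((Ext A (ModuleCat.{u} A) n).obj (op N)).obj X) : Prop :=
  ∃ z : ((homChainComplex P X).opcycles n).unop,
    ((homChainComplex P X).pOpcycles n).unop.hom z = f ∧
    ((leftDerivedHomIso P X n).hom ≫ (homChainComplex P X).homologyι n).unop.hom z = x

namespace Represents

variable {N X : ModuleCat.{u} A} {P : ProjectiveResolution N} {n : ℕ}

theorem exists_cocycle (x : ((Ext A (ModuleCat.{u} A) n).obj (op N)).obj X) :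
    ∃ f : P.complex.X n ⟶ X, Represents P f x := by
  -- In the opposite category homology embeds into opcycles; reversing arrows, this is the
  -- projection from cocycles onto cohomology.
  have : Epi ((leftDerivedHomIso P X n).hom ≫ (homChainComplex P X).homologyι n).unop :=
    inferInstance
  obtain ⟨z, hz⟩ := (ModuleCat.epi_iff_surjective _).1 this x
  exact ⟨_, z, rfl, hz⟩

theorem d_comp_eq_zero {f : P.complex.X n ⟶ X}
    {x : ((Ext A (ModuleCat.{u} A) n).obj (op N)).obj X} (h : Represents P f x) (m : ℕ) :
    P.complex.d m n ≫ f = 0 := by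
  obtain ⟨z, rfl, -⟩ := h
  have := (homChainComplex P X).d_pOpcycles m n
  exact congr($(congrArg Quiver.Hom.unop this).hom z)

theorem exists_class {f : P.complex.X n ⟶ X} (h : P.complex.d (n + 1) n ≫ f = 0) :
    ∃ x, Represents P f x := by
  let K := homChainComplex P X
  have hex : (ShortComplex.mk _ _ (K.d_pOpcycles (n + 1) n)).Exact :=
    ShortComplex.exact_of_g_is_cokernel _ (K.opcyclesIsCokernel (n + 1) n (by simp))
  have := (ShortComplex.moduleCat_exact_iff _).1 hex.unop f h
  obtain ⟨z, hz⟩ := this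
  exact ⟨_, z, hz, rfl⟩

/-- A class vanishes exactly when its cocycle is a coboundary. The index `next n` is `n - 1` for
positive `n`; for `n = 0` the differential to `next 0` is zero, and the criterion correctly reads `f
= 0`. -/
theorem eq_zero_iff {f : P.complex.X n ⟶ X}
    {x : ((Ext A (ModuleCat.{u} A) n).obj (op N)).obj X} (h : Represents P f x) :
    x = 0 ↔ ∃ g : P.complex.X ((ComplexShape.down ℕ).next n) ⟶ X, P.complex.d n _ ≫ g = f := by
  let K := homChainComplex P X
  obtain ⟨z, rfl, rfl⟩ := h
  have hex : (ShortComplex.mk _ _ (K.homologyι_comp_fromOpcycles n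
      ((ComplexShape.down ℕ).next n))).Exact :=
    ShortComplex.exact_of_f_is_kernel _ (K.homologyIsKernel n _ rfl)
  have hm : Function.Injective (K.pOpcycles n).unop.hom :=
    (ModuleCat.mono_iff_injective _).1 inferInstance
  constructor
  · intro hz
    have hz' : (K.homologyι n).unop.hom z = 0 := by
      refine (ModuleCat.mono_iff_injective (leftDerivedHomIso P X n).hom.unop).1 inferInstance ?_
      exact hz.trans (map_zero _).symm
    obtain ⟨g, hg⟩ := (ShortComplex.moduleCat_exact_iff _).1 hex.unop z hz'
    refine ⟨g, ?_⟩
    rw [← hg]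
    exact congr($(congrArg Quiver.Hom.unop
      (K.p_fromOpcycles n ((ComplexShape.down ℕ).next n))).hom g).symm
  · rintro ⟨g, hg⟩
    have hz : z = (K.fromOpcycles n ((ComplexShape.down ℕ).next n)).unop.hom g := by
      apply hm
      refine hg.symm.trans ?_
      exact congr($(congrArg Quiver.Hom.unop
        (K.p_fromOpcycles n ((ComplexShape.down ℕ).next n))).hom g).symm
    have h0 : (K.homologyι n).unop.hom z = 0 := by
      rw [hz]
      exact congr($(congrArg Quiver.Hom.unop (K.homologyι_comp_fromOpcycles n
        ((ComplexShape.down ℕ).next n))).hom g)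
    exact (congrArg (leftDerivedHomIso P X n).hom.unop.hom h0).trans (map_zero _)

theorem precomp {f : P.complex.X n ⟶ X}
    {x : ((Ext A (ModuleCat.{u} A) n).obj (op N)).obj X} (h : Represents P f x)
    {N' : ModuleCat.{u} A} {P' : ProjectiveResolution N'} {g : N' ⟶ N}
    (φ : ProjectiveResolution.Hom P' P g) :
    Represents P' (φ.hom.f n ≫ f) ((((Ext A (ModuleCat.{u} A) n).map g.op).app X).hom x) := by
  obtain ⟨z, rfl, rfl⟩ := h
  let F := ((linearYoneda A (ModuleCat.{u} A)).obj X).rightOp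
  let Φ : homChainComplex P' X ⟶ homChainComplex P X :=
    (F.mapHomologicalComplex (ComplexShape.down ℕ)).map φ.hom
  refine ⟨(HomologicalComplex.opcyclesMap Φ n).unop.hom z, ?_, ?_⟩
  · exact congr($(congrArg Quiver.Hom.unop (HomologicalComplex.p_opcyclesMap Φ n)).hom z)
  · have h1 : (F.leftDerived n).map g ≫ (leftDerivedHomIso P X n).hom =
        (leftDerivedHomIso P' X n).hom ≫ HomologicalComplex.homologyMap Φ n :=
      ProjectiveResolution.isoLeftDerivedObj_hom_naturality g P' P φ.hom
        (by simpa using φ.hom_f_zero_comp_π_f_zero) F n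
    have h3 : (F.leftDerived n).map g ≫ (leftDerivedHomIso P X n).hom ≫
        (homChainComplex P X).homologyι n = ((leftDerivedHomIso P' X n).hom ≫
        (homChainComplex P' X).homologyι n) ≫ HomologicalComplex.opcyclesMap Φ n := by
      rw [Category.assoc, ← HomologicalComplex.homologyι_naturality Φ n, reassoc_of% h1]
    exact congr($(congrArg Quiver.Hom.unop h3).hom z).symm

end Represents

theorem CategoryTheory.ProjectiveResolution.extMk_eq_zero_iff_next {N X : ModuleCat.{u} A}
    (P : ProjectiveResolution N) {n : ℕ} (f : P.complex.X n ⟶ X)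
    (hf : P.complex.d (n + 1) n ≫ f = 0) :
    P.extMk f (n + 1) rfl hf = 0 ↔
      ∃ g : P.complex.X ((ComplexShape.down ℕ).next n) ⟶ X, P.complex.d n _ ≫ g = f := by
  cases n with
  | succ p =>
    rw [P.extMk_eq_zero_iff f _ rfl hf p rfl]
    rw [ChainComplex.next_nat_succ]
  | zero =>
    have hd : P.complex.d 0 ((ComplexShape.down ℕ).next 0) = 0 :=
      P.complex.shape _ _ (by simp)
    simp only [hd, zero_comp]
    constructor
    · intro h
      refine ⟨0, ?_⟩
      rw [← P.extEquivCohomologyClass.apply_eq_iff_eq,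
        ProjectiveResolution.extEquivCohomologyClass_extMk,
        ProjectiveResolution.extEquivCohomologyClass_zero,
        CochainComplex.HomComplex.CohomologyClass.mk_eq_zero_iff,
        CochainComplex.HomComplex.Cocycle.toSingleMk_mem_coboundaries_iff _ _ _ _ _ 1 (by simp)]
        at h
      obtain ⟨g, hg⟩ := h
      -- A degree 0 coboundary would factor through cochain degree 1, where a resolution is zero.
      have h0 : IsZero (P.cochainComplex.X 1) := P.cochainComplex.isZero_of_isStrictlyLE 0 1
      rw [h0.eq_of_src g 0, comp_zero] at hg
      rw [← cancel_epi (P.cochainComplexXIso (-((0 : ℕ) : ℤ)) 0 rfl).hom]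
      rw [← hg, comp_zero]
    · rintro ⟨_, rfl⟩
      simp

/-- The surjection `A ⧸ I ^ m ⟶ A ⧸ I ^ n` for `n ≤ m`. -/
def powQuotientMap (I : Ideal A) {n m : ℕ} (h : n ≤ m) :
    ModuleCat.of A (A ⧸ I ^ m) ⟶ ModuleCat.of A (A ⧸ I ^ n) :=
  ModuleCat.ofHom (Submodule.mapQ _ _ LinearMap.id (Ideal.pow_le_pow_right h))

theorem powQuotientMap_comp (I : Ideal A) {n m l : ℕ} (h : n ≤ m) (h' : m ≤ l) :
    powQuotientMap I h' ≫ powQuotientMap I h = powQuotientMap I (h.trans h') := by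
  refine ModuleCat.hom_ext (LinearMap.ext fun x => ?_)
  obtain ⟨x, rfl⟩ := Submodule.Quotient.mk_surjective _ x
  rfl

/-- Every class in `Ext^i(A ⧸ I ^ n, X)` becomes zero in `Ext^i(A ⧸ I ^ m, X)` for some `m ≥ n`;
that is, `H^i_I(X) = 0`. -/
def LocalCohomologyVanishes (I : Ideal A) (X : ModuleCat.{u} A) (i : ℕ) : Prop :=
  ∀ (n : ℕ) (e : Abelian.Ext (ModuleCat.of A (A ⧸ I ^ n)) X i),
    ∃ (m : ℕ) (h : n ≤ m), (Abelian.Ext.mk₀ (powQuotientMap I h)).comp e (zero_add i) = 0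

theorem isZero_colimit_iff_forall {J : Type} [SmallCategory J] [IsFiltered J]
    (F : J ⥤ ModuleCat.{u} A) :
    IsZero (colimit F) ↔ ∀ (j : J) (x : F.obj j), ∃ (j' : J) (f : j ⟶ j'), (F.map f).hom x = 0 := by
  have : PreservesFilteredColimitsOfSize.{0, 0} (forget (ModuleCat.{u} A)) :=
    preservesFilteredColimitsOfSize_shrink.{0, u, 0, u} _
  constructor
  · intro h j x
    refine Concrete.colimit_rep_eq_zero A F _ x ?_
    rw [h.eq_of_tgt (colimit.ι F j) 0]
    rfl
  · intro h
    rw [ModuleCat.isZero_iff_subsingleton]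
    refine subsingleton_of_forall_eq 0 fun y => ?_
    obtain ⟨j, x, rfl⟩ := Concrete.colimit_exists_rep F y
    obtain ⟨j', f, hx⟩ := h j x
    rw [← colimit.w F f]
    exact (congrArg (colimit.ι F j').hom hx).trans (map_zero _)

theorem isZero_localCohomology_iff_forall (I : Ideal A) (X : ModuleCat.{u} A) (i : ℕ) :
    IsZero ((localCohomology I i).obj X) ↔
      ∀ (n : ℕ) (x : ((Ext A (ModuleCat.{u} A) i).obj (op (ModuleCat.of A (A ⧸ I ^ n)))).obj X),
        ∃ (m : ℕ) (h : n ≤ m),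
          (((Ext A (ModuleCat.{u} A) i).map (powQuotientMap I h).op).app X).hom x = 0 := by
  let D := localCohomology.diagram (localCohomology.idealPowersDiagram I) i
  let e : (localCohomology I i).obj X ≅ colimit (D ⋙ (evaluation _ _).obj X) :=
    colimitObjIsoColimitCompEvaluation D X
  rw [e.isZero_iff, isZero_colimit_iff_forall]
  constructor
  · intro h n x
    obtain ⟨j, f, hf⟩ := h (op (op n)) x
    exact ⟨j.unop.unop, leOfHom f.unop.unop, hf⟩
  · intro h j x
    obtain ⟨m, hm, hx⟩ := h j.unop.unop x
    exact ⟨op (op m), (homOfLE hm).op.op, hx⟩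

/-- Both versions of Ext describe classes by cocycles on the same projective resolution, restrict
them along the same chain maps, and detect zero by the same coboundary condition. Vanishing thus
transfers cocycle by cocycle, with no isomorphism between the two theories being constructed. -/
theorem isZero_localCohomology_iff (I : Ideal A) (X : ModuleCat.{u} A) (i : ℕ) :
    IsZero ((localCohomology I i).obj X) ↔ LocalCohomologyVanishes I X i := by
  rw [isZero_localCohomology_iff_forall]
  let P (n : ℕ) := projectiveResolution (ModuleCat.of A (A ⧸ I ^ n))
  let φ {n m : ℕ} (h : n ≤ m) : ProjectiveResolution.Hom (P m) (P n) (powQuotientMap I h) :=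
    { hom := ProjectiveResolution.lift _ _ _
      hom_f_zero_comp_π_f_zero := by
        rw [← HomologicalComplex.comp_f, ProjectiveResolution.lift_commutes,
          HomologicalComplex.comp_f] }
  constructor
  · intro H n e
    obtain ⟨f, hf, rfl⟩ := (P n).extMk_surjective e _ rfl
    obtain ⟨x, hx⟩ := Represents.exists_class hf
    obtain ⟨m, h, h0⟩ := H n x
    refine ⟨m, h, ?_⟩
    rw [ProjectiveResolution.mk₀_comp_extMk f _ rfl hf (φ h),
      ProjectiveResolution.extMk_eq_zero_iff_next]
    exact (hx.precomp (φ h)).eq_zero_iff.1 h0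
  · intro H n x
    obtain ⟨f, hx⟩ := Represents.exists_cocycle (P := P n) x
    have hf := hx.d_comp_eq_zero (i + 1)
    obtain ⟨m, h, h0⟩ := H n ((P n).extMk f _ rfl hf)
    refine ⟨m, h, ?_⟩
    rw [ProjectiveResolution.mk₀_comp_extMk f _ rfl hf (φ h),
      ProjectiveResolution.extMk_eq_zero_iff_next] at h0
    exact (hx.precomp (φ h)).eq_zero_iff.2 h0

theorem natCast_le_depthAt_iff (I : Ideal A) (X : ModuleCat.{u} A) (d : ℕ) :
    (d : ℕ∞) ≤ depthAt I X ↔ ∀ i < d, LocalCohomologyVanishes I X i := by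
  simp only [depthAt, le_iInf_iff, ← isZero_localCohomology_iff]
  constructor
  · intro h i hi
    by_contra h0
    exact absurd (Nat.cast_le.1 (h i h0)) (by omega)
  · intro h i h0
    by_contra hi
    exact h0 (h i (Nat.cast_lt.1 (not_le.1 hi)))

end Comparison

/-! ### Elementwise exact sequences for local cohomology -/

section LocalCohomologyVanishing

open Abelian

variable {A : Type u} [CommRing A] {I : Ideal A}

/-- The restriction of a class in `Ext^i(A ⧸ I ^ n, X)` to `A ⧸ I ^ m`, for `n ≤ m`. -/
abbrev extPowRestrict {n m : ℕ} (h : n ≤ m) {X : ModuleCat.{u} A} {i : ℕ}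
    (e : Abelian.Ext (ModuleCat.of A (A ⧸ I ^ n)) X i) :
    Abelian.Ext (ModuleCat.of A (A ⧸ I ^ m)) X i :=
  (Ext.mk₀ (powQuotientMap I h)).comp e (zero_add i)

theorem extPowRestrict_trans {n m l : ℕ} (h : n ≤ m) (h' : m ≤ l) {X : ModuleCat.{u} A} {i : ℕ}
    (e : Abelian.Ext (ModuleCat.of A (A ⧸ I ^ n)) X i) :
    extPowRestrict h' (extPowRestrict h e) = extPowRestrict (h.trans h') e := by
  rw [extPowRestrict, Ext.mk₀_comp_mk₀_assoc, powQuotientMap_comp]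

theorem extPowRestrict_comp {n m : ℕ} (h : n ≤ m) {X Y : ModuleCat.{u} A} {i j l : ℕ}
    (e : Abelian.Ext (ModuleCat.of A (A ⧸ I ^ n)) X i) (f : Abelian.Ext X Y j) (hl : i + j = l) :
    extPowRestrict h (e.comp f hl) = (extPowRestrict h e).comp f hl :=
  (Ext.comp_assoc _ _ _ _ _ (by omega)).symm

theorem extPowRestrict_eq_zero_of_le {n m l : ℕ} (h : n ≤ m) (h' : m ≤ l) {X : ModuleCat.{u} A}
    {i : ℕ} (e : Abelian.Ext (ModuleCat.of A (A ⧸ I ^ n)) X i) (he : extPowRestrict h e = 0) :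
    extPowRestrict (h.trans h') e = 0 := by
  rw [← extPowRestrict_trans h h', he, extPowRestrict, Ext.comp_zero]

namespace LocalCohomologyVanishes

/-- A class dying in `X₂` after one restriction comes from `X₃` in degree `i - 1`, where a further
restriction kills it. Writing `j + 1 = i` makes the condition on `X₃` empty in degree 0. -/
theorem of_shortExact₁ {S : ShortComplex (ModuleCat.{u} A)} (hS : S.ShortExact) {i : ℕ}
    (h₂ : LocalCohomologyVanishes I S.X₂ i)
    (h₃ : ∀ j, j + 1 = i → LocalCohomologyVanishes I S.X₃ j) :
    LocalCohomologyVanishes I S.X₁ i := by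
  intro n e
  obtain ⟨m, h, hm⟩ := h₂ n (e.comp (Ext.mk₀ S.f) (add_zero i))
  change extPowRestrict h _ = 0 at hm
  rw [extPowRestrict_comp] at hm
  cases i with
  | zero =>
    refine ⟨m, h, ?_⟩
    have := hS.mono_f
    apply Ext.postcomp_mk₀_injective_of_mono _ S.f
    change (extPowRestrict h e).comp _ (add_zero 0) = Ext.comp 0 (Ext.mk₀ S.f) (add_zero 0)
    rw [hm, Ext.zero_comp]
  | succ i =>
    obtain ⟨w, hw⟩ := Ext.covariant_sequence_exact₁ _ hS _ hm (n₀ := i) rfl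
    obtain ⟨l, h', hl⟩ := h₃ i rfl m w
    change extPowRestrict h' _ = 0 at hl
    refine ⟨l, h.trans h', ?_⟩
    change extPowRestrict _ _ = 0
    rw [← extPowRestrict_trans h h', ← hw, extPowRestrict_comp, hl, Ext.zero_comp]

theorem of_shortExact₃ {S : ShortComplex (ModuleCat.{u} A)} (hS : S.ShortExact) {i : ℕ}
    (h₁ : LocalCohomologyVanishes I S.X₁ (i + 1)) (h₂ : LocalCohomologyVanishes I S.X₂ i) :
    LocalCohomologyVanishes I S.X₃ i := by
  intro n e
  obtain ⟨m, h, hm⟩ := h₁ n (e.comp hS.extClass rfl)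
  change extPowRestrict h _ = 0 at hm
  rw [extPowRestrict_comp] at hm
  obtain ⟨w, hw⟩ := Ext.covariant_sequence_exact₃ _ hS _ _ hm
  obtain ⟨l, h', hl⟩ := h₂ m w
  change extPowRestrict h' _ = 0 at hl
  refine ⟨l, h.trans h', ?_⟩
  change extPowRestrict _ _ = 0
  rw [← extPowRestrict_trans h h', ← hw, extPowRestrict_comp, hl, Ext.zero_comp]

theorem of_sum_eq_id {ι : Type*} [Fintype ι] {Y : ModuleCat.{u} A} {Z : ι → ModuleCat.{u} A}
    (p : ∀ t, Y ⟶ Z t) (q : ∀ t, Z t ⟶ Y) (hpq : ∑ t, p t ≫ q t = 𝟙 Y) {i : ℕ}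
    (hZ : ∀ t, LocalCohomologyVanishes I (Z t) i) : LocalCohomologyVanishes I Y i := by
  intro n e
  choose m h hm using fun t => hZ t n (e.comp (Ext.mk₀ (p t)) (add_zero i))
  -- A single exponent beyond all the `m t`, so that every summand of the identity dies at once.
  let M := n + ∑ t, m t
  have hM (t) : m t ≤ M :=
    (Finset.single_le_sum (fun _ _ => Nat.zero_le _) (Finset.mem_univ t)).trans
      (Nat.le_add_left _ _)
  refine ⟨M, Nat.le_add_right _ _, ?_⟩
  change extPowRestrict _ e = 0
  rw [← Ext.comp_mk₀_id (extPowRestrict _ e), ← hpq, Ext.mk₀_sum, Ext.comp_sum]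
  refine Finset.sum_eq_zero fun t _ => ?_
  rw [← Ext.mk₀_comp_mk₀, ← Ext.comp_assoc_of_third_deg_zero, ← extPowRestrict_comp]
  have := extPowRestrict_eq_zero_of_le (h t) (hM t) _ (hm t)
  rw [this, Ext.zero_comp]

theorem of_retract {Y Z : ModuleCat.{u} A} (p : Y ⟶ Z) (q : Z ⟶ Y) (hpq : p ≫ q = 𝟙 Y) {i : ℕ}
    (hZ : LocalCohomologyVanishes I Z i) : LocalCohomologyVanishes I Y i :=
  of_sum_eq_id (ι := Unit) (fun _ => p) (fun _ => q) (by simpa using hpq) fun _ => hZ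

/-- `H^0_I(X) = 0` means that no nonzero element of `X` is killed by `I`. -/
theorem eq_zero_of_forall_smul_eq_zero {X : ModuleCat.{u} A}
    (hX : LocalCohomologyVanishes I X 0) (x : X) (hx : ∀ a ∈ I, a • x = 0) : x = 0 := by
  let φ : A ⧸ I ^ 1 →ₗ[A] X := Submodule.liftQ _ (LinearMap.toSpanSingleton A X x) (by
    intro a ha
    rw [pow_one] at ha
    exact hx a ha)
  obtain ⟨m, h, hm⟩ := hX 1 (Ext.mk₀ (ModuleCat.ofHom φ))
  rw [Ext.mk₀_comp_mk₀] at hm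
  rw [← Ext.mk₀_zero] at hm
  have h0 := congr($((Ext.mk₀_bijective _ _).1 hm).hom (Submodule.Quotient.mk 1))
  exact (one_smul A x).symm.trans h0

end LocalCohomologyVanishes

/-- Multiplication by `a` as an endomorphism of a module. -/
def ModuleCat.mulHom (X : ModuleCat.{u} A) (a : A) : X ⟶ X :=
  ModuleCat.ofHom (LinearMap.lsmul A X a)

theorem ModuleCat.mulHom_mul (X : ModuleCat.{u} A) (a b : A) :
    X.mulHom (a * b) = X.mulHom b ≫ X.mulHom a := by
  ext x; exact mul_smul a b x

theorem ext_comp_mulHom {X Y : ModuleCat.{u} A} {i : ℕ} (e : Abelian.Ext X Y i) (a : A) :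
    e.comp (Ext.mk₀ (Y.mulHom a)) (add_zero i) =
      (Ext.mk₀ (X.mulHom a)).comp e (zero_add i) := by
  have hX : X.mulHom a = a • 𝟙 X := by ext x; rfl
  have hY : Y.mulHom a = a • 𝟙 Y := by ext x; rfl
  rw [hX, hY, Ext.mk₀_smul, Ext.mk₀_smul, Ext.comp_smul, Ext.smul_comp, Ext.comp_mk₀_id,
    Ext.mk₀_id_comp]

/-- Elements of `I ^ n` act as zero on `Ext^i(A ⧸ I ^ n, X)`. -/
theorem ext_comp_mulHom_eq_zero {X : ModuleCat.{u} A} {n i : ℕ}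
    (e : Abelian.Ext (ModuleCat.of A (A ⧸ I ^ n)) X i) {a : A} (ha : a ∈ I ^ n) :
    e.comp (Ext.mk₀ (X.mulHom a)) (add_zero i) = 0 := by
  have : (ModuleCat.of A (A ⧸ I ^ n)).mulHom a = 0 := by
    refine ModuleCat.hom_ext (LinearMap.ext fun x => ?_)
    obtain ⟨x, rfl⟩ := Submodule.Quotient.mk_surjective _ x
    refine (Submodule.Quotient.mk_eq_zero _).2 ?_
    exact Ideal.mul_mem_right x _ ha
  rw [ext_comp_mulHom, this, Ext.mk₀_zero, Ext.zero_comp]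

/-- If `H^{i-1}(Z) = 0`, then `y` is injective on `H^i(X)`. Yet every class is killed by a power of
`y`, because `I ^ n` annihilates `Ext^i(A ⧸ I ^ n, X)`. Induction on that power forces the class to
vanish. -/
theorem LocalCohomologyVanishes.of_regular {X Z : ModuleCat.{u} A} {y : A} (hy : y ∈ I)
    {g : X ⟶ Z} (w : X.mulHom y ≫ g = 0) (hS : (ShortComplex.mk _ _ w).ShortExact) {i : ℕ}
    (hZ : ∀ j, j + 1 = i → LocalCohomologyVanishes I Z j) : LocalCohomologyVanishes I X i := by
  have key : ∀ (N : ℕ) (n : ℕ) (e : Abelian.Ext (ModuleCat.of A (A ⧸ I ^ n)) X i),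
      e.comp (Ext.mk₀ (X.mulHom (y ^ N))) (add_zero i) = 0 →
      ∃ (m : ℕ) (h : n ≤ m), extPowRestrict h e = 0 := by
    intro N
    induction N with
    | zero =>
      intro n e he
      refine ⟨n, le_rfl, ?_⟩
      have : X.mulHom (y ^ 0) = 𝟙 X := by
        ext x
        change (y ^ 0) • x = x
        rw [pow_zero, one_smul]
      rw [this, Ext.comp_mk₀_id] at he
      rw [he, extPowRestrict, Ext.comp_zero]
    | succ N IH =>
      intro n e he
      rw [pow_succ, ModuleCat.mulHom_mul, ← Ext.mk₀_comp_mk₀,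
        ← Ext.comp_assoc_of_third_deg_zero] at he
      obtain ⟨m, h, hm⟩ := IH n _ he
      rw [extPowRestrict_comp] at hm
      cases i with
      | zero =>
        refine ⟨m, h, ?_⟩
        have := hS.mono_f
        apply Ext.postcomp_mk₀_injective_of_mono _ (X.mulHom y)
        change (extPowRestrict h e).comp _ (add_zero 0) = Ext.comp 0 (Ext.mk₀ (X.mulHom y)) (add_zero 0)
        rw [hm, Ext.zero_comp]
      | succ i =>
        obtain ⟨w, hw⟩ := Ext.covariant_sequence_exact₁ _ hS _ hm (n₀ := i) rfl
        obtain ⟨l, h', hl⟩ := hZ i rfl m w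
        change extPowRestrict h' _ = 0 at hl
        refine ⟨l, h.trans h', ?_⟩
        rw [← extPowRestrict_trans h h', ← hw, extPowRestrict_comp, hl, Ext.zero_comp]
  exact fun n e => key n n e (ext_comp_mulHom_eq_zero e (Ideal.pow_mem_pow hy n))

end LocalCohomologyVanishing

/-! ### Independence of depth from the ring; regular sequences -/

section ChangeOfRings

open Abelian

variable {A B C : Type u} [CommRing A] [CommRing B] [CommRing C]

/-- The endomorphism of a restriction of scalars given by multiplication by `c`. -/
def restrictMulHom (g : B →+* C) (Z : ModuleCat.{u} C) (c : C) :
    (ModuleCat.restrictScalars g).obj Z ⟶ (ModuleCat.restrictScalars g).obj Z :=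
  (ModuleCat.restrictScalars g).map (Z.mulHom c)

theorem ext_comp_restrictMulHom_eq_zero (g : B →+* C) (J : Ideal B) (Z : ModuleCat.{u} C)
    {n i : ℕ} (e : Abelian.Ext (ModuleCat.of B (B ⧸ J ^ n)) ((ModuleCat.restrictScalars g).obj Z) i)
    {c : C} (hc : c ∈ (J ^ n).map g) :
    e.comp (Ext.mk₀ (restrictMulHom g Z c)) (add_zero i) = 0 := by
  induction hc using Submodule.span_induction with
  | mem c hc =>
    obtain ⟨b, hb, rfl⟩ := hc
    exact ext_comp_mulHom_eq_zero e hb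
  | zero =>
    have : restrictMulHom g Z 0 = 0 := by ext x; exact zero_smul C (x : Z)
    rw [this, Ext.mk₀_zero, Ext.comp_zero]
  | add c c' _ _ h h' =>
    have : restrictMulHom g Z (c + c') = restrictMulHom g Z c + restrictMulHom g Z c' := by
      ext x; exact add_smul c c' (x : Z)
    rw [this, Ext.mk₀_add, Ext.comp_add, h, h', add_zero]
  | smul a c _ h =>
    have : restrictMulHom g Z (a • c) = restrictMulHom g Z c ≫ restrictMulHom g Z a := by
      ext x; exact mul_smul a c (x : Z)
    rw [this, ← Ext.mk₀_comp_mk₀, ← Ext.comp_assoc_of_third_deg_zero, h, Ext.zero_comp]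

/-- A power of `c` lies in `J ^ n C`, so it acts on `Ext^i(B ⧸ J ^ n, Z)` both as zero and
invertibly. Hence this group is already zero, and `m = n` suffices. -/
theorem LocalCohomologyVanishes.of_bijective_smul (g : B →+* C) (J : Ideal B) (Z : ModuleCat.{u} C)
    {c : C} (hc : c ∈ (J.map g).radical) (hZ : Function.Bijective fun z : Z => c • z) (i : ℕ) :
    LocalCohomologyVanishes J ((ModuleCat.restrictScalars g).obj Z) i := by
  intro n e
  refine ⟨n, le_rfl, ?_⟩
  obtain ⟨N, hN⟩ := hc
  have h1 : (c ^ N) ^ n ∈ (J ^ n).map g := by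
    rw [Ideal.map_pow]
    exact Ideal.pow_mem_pow hN n
  have h2 : IsIso (restrictMulHom g Z ((c ^ N) ^ n)) := by
    rw [ConcreteCategory.isIso_iff_bijective]
    change Function.Bijective fun z : Z => ((c ^ N) ^ n) • z
    rw [← pow_mul]
    have : (fun z : Z => c ^ (N * n) • z) = (fun z : Z => c • z)^[N * n] := by
      ext z
      rw [smul_iterate]
    rw [this]
    exact hZ.iterate _
  have h3 := ext_comp_restrictMulHom_eq_zero g J Z e h1
  have h4 : e = 0 := by
    rw [← Ext.comp_mk₀_id e, ← IsIso.hom_inv_id (restrictMulHom g Z ((c ^ N) ^ n)),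
      ← Ext.mk₀_comp_mk₀, ← Ext.comp_assoc_of_third_deg_zero, h3, Ext.zero_comp]
  rw [h4, Ext.comp_zero]

/-- A nonzero element killed by powers of finitely many elements has a nonzero multiple killed by
these elements. -/
theorem exists_smul_ne_zero_of_pow_smul_eq_zero {Z : Type*} [AddCommGroup Z] [Module C Z]
    (s : Finset C) (z : Z) (hz : z ≠ 0) (hs : ∀ c ∈ s, ∃ n : ℕ, c ^ n • z = 0) :
    ∃ a : C, a • z ≠ 0 ∧ ∀ c ∈ s, c • a • z = 0 := by
  classical
  induction s using Finset.induction_on with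
  | empty => exact ⟨1, by simpa using hz, by simp⟩
  | insert c s _ IH =>
    obtain ⟨a, ha, has⟩ := IH fun b hb => hs b (Finset.mem_insert_of_mem hb)
    have hex : ∃ n : ℕ, c ^ n • a • z = 0 := by
      obtain ⟨n, hn⟩ := hs c (Finset.mem_insert_self c s)
      exact ⟨n, by rw [smul_comm, hn, smul_zero]⟩
    have hpos : Nat.find hex ≠ 0 := fun h0 => by
      have := Nat.find_spec hex
      rw [h0, pow_zero, one_smul] at this
      exact ha this
    refine ⟨c ^ (Nat.find hex - 1) * a, ?_, ?_⟩
    · rw [mul_smul]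
      exact Nat.find_min hex (by omega)
    · intro b hb
      rw [mul_smul]
      rcases Finset.mem_insert.1 hb with rfl | hb
      · rw [← mul_smul, ← pow_succ', Nat.sub_add_cancel (Nat.one_le_iff_ne_zero.2 hpos)]
        exact Nat.find_spec hex
      · rw [smul_comm, has b hb, smul_zero]

theorem bijective_smul_localizedModule (c : C) (Z : Type u) [AddCommGroup Z] [Module C Z] :
    Function.Bijective fun z : LocalizedModule (Submonoid.powers c) Z => c • z := by
  have := IsLocalizedModule.map_units (LocalizedModule.mkLinearMap (Submonoid.powers c) Z)
    ⟨c, Submonoid.mem_powers c⟩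
  exact (Module.End.isUnit_iff _).1 this

theorem LocalCohomologyVanishes.pi (g : B →+* C) (J : Ideal B) {ι : Type u} [Fintype ι]
    (Z : ι → Type u) [∀ t, AddCommGroup (Z t)] [∀ t, Module C (Z t)] {i : ℕ}
    (hZ : ∀ t, LocalCohomologyVanishes J
      ((ModuleCat.restrictScalars g).obj (ModuleCat.of C (Z t))) i) :
    LocalCohomologyVanishes J ((ModuleCat.restrictScalars g).obj (ModuleCat.of C (∀ t, Z t))) i := by
  classical
  refine of_sum_eq_id
    (fun t => (ModuleCat.restrictScalars g).map (ModuleCat.ofHom (LinearMap.proj t)))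
    (fun t => (ModuleCat.restrictScalars g).map (ModuleCat.ofHom (LinearMap.single C Z t))) ?_ hZ
  simp_rw [← Functor.map_comp, ← Functor.map_sum]
  refine (congrArg _ ?_).trans ((ModuleCat.restrictScalars g).map_id _)
  refine ModuleCat.hom_ext (LinearMap.ext fun x => ?_)
  rw [ModuleCat.hom_sum, LinearMap.sum_apply]
  exact Finset.univ_sum_single x

/-- A module over `C` on which no nonzero element is killed by `I` embeds into a `C`-module
on which all local cohomology vanishes, for any ideal `J` with `I C ⊆ rad (J C)`. -/
theorem exists_injective_vanishing (f : A →+* C) (g : B →+* C) {I : Ideal A} (hI : I.FG)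
    {J : Ideal B} (hIJ : I.map f ≤ (J.map g).radical) (Z : ModuleCat.{u} C)
    (hZ : LocalCohomologyVanishes I ((ModuleCat.restrictScalars f).obj Z) 0) :
    ∃ (W : ModuleCat.{u} C) (φ : Z ⟶ W), Function.Injective φ ∧ ∀ i,
      LocalCohomologyVanishes I ((ModuleCat.restrictScalars f).obj W) i ∧
      LocalCohomologyVanishes J ((ModuleCat.restrictScalars g).obj W) i := by
  classical
  obtain ⟨s, rfl⟩ := hI
  -- The target is the product of the localizations at generators of `I`. The kernel consists of
  -- elements killed by powers of all generators; a nonzero one would have a nonzero multiple killed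
  -- by `I`, contradicting `H^0_I(Z) = 0`.
  let W (a : s) : Type u := LocalizedModule (Submonoid.powers (f a)) Z
  let φ : Z →ₗ[C] (∀ a, W a) :=
    LinearMap.pi fun a => LocalizedModule.mkLinearMap (Submonoid.powers (f a)) Z
  have hmem (a : s) : f a ∈ (Ideal.span (s : Set A)).map f :=
    Ideal.mem_map_of_mem f (Ideal.subset_span a.2)
  refine ⟨ModuleCat.of C (∀ a, W a), ModuleCat.ofHom φ, ?_, fun i => ⟨?_, ?_⟩⟩
  · refine (injective_iff_map_eq_zero φ).2 fun z hz => ?_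
    by_contra hz0
    obtain ⟨a, ha, has⟩ := exists_smul_ne_zero_of_pow_smul_eq_zero (s.image f) z hz0 (by
      intro c hc
      obtain ⟨b, hb, rfl⟩ := Finset.mem_image.1 hc
      have h1 : LocalizedModule.mkLinearMap (Submonoid.powers (f b)) Z z = 0 :=
        congrFun hz (⟨b, hb⟩ : s)
      rw [IsLocalizedModule.eq_zero_iff (Submonoid.powers (f b))] at h1
      obtain ⟨⟨_, n, rfl⟩, hn⟩ := h1
      exact ⟨n, hn⟩)
    refine ha (hZ.eq_zero_of_forall_smul_eq_zero (a • z) fun b hb => ?_)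
    change f b • a • z = 0
    induction hb using Submodule.span_induction with
    | mem b hb => exact has _ (Finset.mem_image_of_mem f hb)
    | zero => rw [map_zero, zero_smul]
    | add b c _ _ hb hc => rw [map_add, add_smul, hb, hc, add_zero]
    | smul c b _ hb => rw [smul_eq_mul, map_mul, mul_smul, hb, smul_zero]
  · exact LocalCohomologyVanishes.pi f _ W fun a =>
      LocalCohomologyVanishes.of_bijective_smul f _ _ (Ideal.le_radical (hmem a))
        (bijective_smul_localizedModule _ _) i
  · exact LocalCohomologyVanishes.pi g _ W fun a =>
      LocalCohomologyVanishes.of_bijective_smul g _ _ (hIJ (hmem a))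
        (bijective_smul_localizedModule _ _) i

theorem shortExact_restrictScalars_cokernel (f : A →+* C) {Z W : ModuleCat.{u} C} (φ : Z ⟶ W)
    (hφ : Function.Injective φ) :
    (ShortComplex.mk ((ModuleCat.restrictScalars f).map φ) ((ModuleCat.restrictScalars f).map
      (ModuleCat.ofHom (LinearMap.range φ.hom).mkQ)) (by
        rw [← Functor.map_comp]
        ext x
        exact (Submodule.Quotient.mk_eq_zero _).2 ⟨x, rfl⟩)).ShortExact := by
  have hS : (ShortComplex.mk φ (ModuleCat.ofHom (LinearMap.range φ.hom).mkQ) (by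
        ext x
        exact (Submodule.Quotient.mk_eq_zero _).2 ⟨x, rfl⟩)).ShortExact :=
    ModuleCat.shortComplex_shortExact _ (fun x => Submodule.Quotient.mk_eq_zero _) hφ
      (Submodule.mkQ_surjective _)
  exact hS.map_of_exact (ModuleCat.restrictScalars f)

/-- Embed `Z` in a module `W` with no local cohomology for either ideal. Then `W/Z` has the local
cohomology of `Z` shifted down by one degree, for both ideals, and induction on `d` applies to it.
Only `H^0_I(Z) = 0` is needed to find `W`. -/
theorem natCast_le_depthAt_restrictScalars (f : A →+* C) (g : B →+* C) {I : Ideal A} (hI : I.FG)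
    {J : Ideal B} (hIJ : I.map f ≤ (J.map g).radical) (d : ℕ) (Z : ModuleCat.{u} C)
    (h : (d : ℕ∞) ≤ depthAt I ((ModuleCat.restrictScalars f).obj Z)) :
    (d : ℕ∞) ≤ depthAt J ((ModuleCat.restrictScalars g).obj Z) := by
  induction d generalizing Z with
  | zero => simp
  | succ d IH =>
    rw [natCast_le_depthAt_iff] at h
    obtain ⟨W, φ, hφ, hW⟩ := exists_injective_vanishing f g hI hIJ Z (h 0 (Nat.succ_pos d))
    have hA := shortExact_restrictScalars_cokernel f φ hφ
    have hB := shortExact_restrictScalars_cokernel g φ hφ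
    have hQ := IH (ModuleCat.of C (W ⧸ LinearMap.range φ.hom))
      ((natCast_le_depthAt_iff _ _ _).2 fun i hi =>
        LocalCohomologyVanishes.of_shortExact₃ hA (h (i + 1) (Nat.succ_lt_succ hi)) (hW i).1)
    rw [natCast_le_depthAt_iff] at hQ ⊢
    exact fun i hi => LocalCohomologyVanishes.of_shortExact₁ hB (hW i).2
      fun j hj => hQ j (by omega)

/-- Depth does not drop when passing from an ideal `I` of `A` to an ideal `J` of `B` with
`I C ⊆ rad (J C)`, for modules over a common algebra `C`. -/
theorem depthAt_restrictScalars_le (f : A →+* C) (g : B →+* C) {I : Ideal A} (hI : I.FG)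
    {J : Ideal B} (hIJ : I.map f ≤ (J.map g).radical) (Z : ModuleCat.{u} C) :
    depthAt I ((ModuleCat.restrictScalars f).obj Z) ≤
      depthAt J ((ModuleCat.restrictScalars g).obj Z) :=
  ENat.forall_natCast_le_iff_le.1 fun d =>
    natCast_le_depthAt_restrictScalars f g hI hIJ d Z

theorem depthAt_le_of_retract {I : Ideal A} {Y Z : ModuleCat.{u} A} (p : Y ⟶ Z) (q : Z ⟶ Y)
    (hpq : p ≫ q = 𝟙 Y) : depthAt I Z ≤ depthAt I Y :=
  ENat.forall_natCast_le_iff_le.1 fun d h => by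
    rw [natCast_le_depthAt_iff] at h ⊢
    exact fun i hi => (h i hi).of_retract p q hpq

theorem depthAt_eq_of_iso {I : Ideal A} {Y Z : ModuleCat.{u} A} (e : Y ≅ Z) :
    depthAt I Y = depthAt I Z :=
  (depthAt_le_of_retract e.inv e.hom e.inv_hom_id).antisymm
    (depthAt_le_of_retract e.hom e.inv e.hom_inv_id)

/-- Depth of a module on which `y 0, …, y (m - 1)` is a regular sequence, which is
witnessed by a left inverse `ψ i` of each `y i` that commutes with the other `y l`. -/
theorem natCast_le_depthAt_of_leftInverse {I : Ideal A} {m d : ℕ} (E : Type u) [AddCommGroup E]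
    [Module A E] (Z : Type u) [AddCommGroup Z] [Module A Z] (y : Fin m → A) (hy : ∀ i, y i ∈ I)
    (ψ : Fin m → E →+ E) (hψ : ∀ i x, ψ i (y i • x) = x)
    (hψ' : ∀ i l x, i ≠ l → ψ i (y l • x) = y l • ψ i x)
    (q : E →ₗ[A] Z) (hq : Function.Surjective q)
    (hker : ∀ x, q x = 0 ↔ ∃ w : Fin m → E, x = ∑ i, y i • w i)
    (hZ : (d : ℕ∞) ≤ depthAt I (ModuleCat.of A Z)) :
    ((m + d : ℕ) : ℕ∞) ≤ depthAt I (ModuleCat.of A E) := by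
  induction m generalizing E with
  | zero =>
    have hinj : Function.Injective q := (injective_iff_map_eq_zero q).2 fun x hx => by
      obtain ⟨w, hw⟩ := (hker x).1 hx
      simpa using hw
    rw [zero_add, depthAt_eq_of_iso (LinearEquiv.ofBijective q ⟨hinj, hq⟩).toModuleIso]
    exact hZ
  | succ m IH =>
    let T : Submodule A E := LinearMap.range (LinearMap.lsmul A E (y 0))
    have hT (x : E) : x ∈ T ↔ ∃ w, y 0 • w = x := Iff.rfl
    -- The other left inverses commute with `y 0`, so they preserve `y 0 • E` and descend to the
    -- quotient.
    let ψ' (i : Fin m) : E ⧸ T →+ E ⧸ T :=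
      QuotientAddGroup.map T.toAddSubgroup T.toAddSubgroup (ψ i.succ) (by
        rintro _ ⟨w, rfl⟩
        exact ⟨ψ i.succ w, (hψ' i.succ 0 w (Fin.succ_ne_zero i)).symm⟩)
    have hψ'_mk (i : Fin m) (x : E) :
        ψ' i (Submodule.Quotient.mk x) = Submodule.Quotient.mk (ψ i.succ x) := rfl
    let q' : E ⧸ T →ₗ[A] Z := T.liftQ q (by
      rintro _ ⟨w, rfl⟩
      refine (hker _).2 ⟨Fin.cons w 0, ?_⟩
      simp [Fin.sum_univ_succ])
    have hQ := IH (E ⧸ T) (fun i => y i.succ) (fun i => hy _) ψ'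
      (by
        intro i x
        obtain ⟨x, rfl⟩ := Submodule.Quotient.mk_surjective _ x
        rw [← Submodule.Quotient.mk_smul, hψ'_mk, hψ])
      (by
        intro i l x hil
        obtain ⟨x, rfl⟩ := Submodule.Quotient.mk_surjective _ x
        rw [← Submodule.Quotient.mk_smul, hψ'_mk, hψ' _ _ _ (by simpa using hil), hψ'_mk,
          Submodule.Quotient.mk_smul])
      q' (fun z => (hq z).imp' Submodule.Quotient.mk fun x hx => hx)
      (by
        intro x
        obtain ⟨x, rfl⟩ := Submodule.Quotient.mk_surjective _ x
        change q x = 0 ↔ _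
        rw [hker]
        constructor
        · rintro ⟨w, rfl⟩
          refine ⟨fun i => Submodule.Quotient.mk (w i.succ), ?_⟩
          simp_rw [← Submodule.Quotient.mk_smul, ← Submodule.mkQ_apply, ← map_sum]
          refine (Submodule.Quotient.eq _).2 ?_
          rw [Fin.sum_univ_succ, add_sub_cancel_right]
          exact ⟨w 0, rfl⟩
        · rintro ⟨w, hw⟩
          choose v hv using fun i => Submodule.Quotient.mk_surjective _ (w i)
          simp_rw [← hv, ← Submodule.Quotient.mk_smul, ← Submodule.mkQ_apply, ← map_sum] at hw
          obtain ⟨w0, hw0⟩ := (Submodule.Quotient.eq _).1 hw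
          refine ⟨Fin.cons w0 v, ?_⟩
          rw [Fin.sum_univ_succ, Fin.cons_zero]
          simp only [Fin.cons_succ]
          exact (eq_add_of_sub_eq hw0.symm))
    have hS : (ShortComplex.mk ((ModuleCat.of A E).mulHom (y 0)) (ModuleCat.ofHom T.mkQ) (by
        ext x
        exact (Submodule.Quotient.mk_eq_zero _).2 ⟨x, rfl⟩)).ShortExact := by
      refine ModuleCat.shortComplex_shortExact _ ?_ ?_ ?_
      · intro x
        exact Submodule.Quotient.mk_eq_zero _
      · exact Function.LeftInverse.injective (g := ψ 0) fun x => hψ 0 x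
      · exact Submodule.mkQ_surjective _
    rw [natCast_le_depthAt_iff] at hQ ⊢
    exact fun i hi => LocalCohomologyVanishes.of_regular (hy 0) _ hS fun j hj => hQ j (by omega)

end ChangeOfRings

/-! ### Dimension shifting and the depth of Hom -/

section ExtModules

open Abelian

variable {A : Type u} [CommRing A] {𝒞 : Type v} [Category.{u} 𝒞] [Abelian 𝒞] [HasExt.{u} 𝒞]
  {Y : 𝒞} (φ : A →+* End Y)

/-- `Hom(M, Y)` as a module over a ring `A` acting on `Y`. -/
def homModule (M : 𝒞) : ModuleCat.{u} A :=
  (ModuleCat.restrictScalars φ).obj (ModuleCat.of (End Y) (M ⟶ Y))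

/-- `Ext^j(M, Y)` as a module over a ring `A` acting on `Y`. -/
def extModule (M : 𝒞) (j : ℕ) : ModuleCat.{u} A :=
  (ModuleCat.restrictScalars φ).obj (ModuleCat.of (End Y) (Ext M Y j))

/-- The Yoneda product with a class `α` in `Ext^a(M', M)`, as an `A`-linear map from
`Ext^j(M, Y)` to `Ext^l(M', Y)`. -/
def extPrecomp {M' M : 𝒞} {a : ℕ} (α : Ext M' M a) {j l : ℕ} (h : a + j = l) :
    extModule φ M j ⟶ extModule φ M' l :=
  (ModuleCat.restrictScalars φ).map (X := ModuleCat.of (End Y) (Ext M Y j))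
    (Y := ModuleCat.of (End Y) (Ext M' Y l)) (ModuleCat.ofHom
    { toFun := fun e => α.comp e h
      map_add' := fun e e' => Ext.comp_add ..
      map_smul' := fun f e => by
        change α.comp (e.comp (Ext.mk₀ f) _) h = (α.comp e h).comp (Ext.mk₀ f) _
        rw [Ext.comp_assoc_of_third_deg_zero] })

/-- `Ext^0(M, Y) ≅ Hom(M, Y)`. -/
def homModuleIso (M : 𝒞) : homModule φ M ≅ extModule φ M 0 :=
  (ModuleCat.restrictScalars φ).mapIso (X := ModuleCat.of (End Y) (M ⟶ Y))
    (Y := ModuleCat.of (End Y) (Ext M Y 0)) (LinearEquiv.toModuleIso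
    (LinearEquiv.ofBijective
      ({ toFun := fun f => Ext.mk₀ f
         map_add' := fun f g => Ext.mk₀_add f g
         map_smul' := fun f g => (Ext.mk₀_comp_mk₀ g f).symm } :
        (M ⟶ Y) →ₗ[End Y] Ext M Y 0) (Ext.mk₀_bijective M Y)))

/-- The kernel `K` of the connecting map `Ext^0(X₁, Y) → Ext^1(X₃, Y)` is also the image of
`Ext^0(X₂, Y)`. Each of the two short exact sequences through `K` costs one degree, so `Ext^1`
contributes its depth plus 2 and `Ext^0(X₁, Y)` its depth plus 1. -/
theorem natCast_succ_le_depthAt_extModule_zero {S : ShortComplex 𝒞} (hS : S.ShortExact)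
    (I : Ideal A) (d : ℕ) (hExt : Subsingleton (Ext S.X₂ Y 1))
    (h₂ : ((d + 1 : ℕ) : ℕ∞) ≤ depthAt I (extModule φ S.X₂ 0))
    (h₁ : (d : ℕ∞) ≤ depthAt I (extModule φ S.X₁ 0))
    (h₃ : ((d + 1 : ℕ) : ℕ∞) ≤ depthAt I (extModule φ S.X₃ 1) + 2) :
    ((d + 1 : ℕ) : ℕ∞) ≤ depthAt I (extModule φ S.X₃ 0) := by
  let δ := extPrecomp φ hS.extClass (add_zero 1)
  let r := extPrecomp φ (Ext.mk₀ S.f) (zero_add 0)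
  let p := extPrecomp φ (Ext.mk₀ S.g) (zero_add 0)
  let K := LinearMap.ker δ.hom
  have hr (e : extModule φ S.X₂ 0) : r.hom e ∈ K := by
    change hS.extClass.comp ((Ext.mk₀ S.f).comp e (zero_add 0)) (add_zero 1) = 0
    exact hS.extClass_comp_assoc e
  have hK : (ShortComplex.mk (ModuleCat.ofHom K.subtype) δ (by ext x; exact x.2)).ShortExact := by
    refine ModuleCat.shortComplex_shortExact _ ?_ Subtype.val_injective ?_
    · intro x
      exact ⟨fun h => ⟨⟨x, h⟩, rfl⟩, fun ⟨y, hy⟩ => hy ▸ y.2⟩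
    · intro x
      exact Ext.contravariant_sequence_exact₃ hS Y x (hExt.elim _ _) (add_zero 1)
  have hrp (e : Ext S.X₃ Y 0) :
      (Ext.mk₀ S.f).comp ((Ext.mk₀ S.g).comp e (zero_add 0)) (zero_add 0) = 0 := by
    rw [Ext.mk₀_comp_mk₀_assoc, S.zero, Ext.mk₀_zero, Ext.zero_comp]
  let r' : extModule φ S.X₂ 0 ⟶ ModuleCat.of A K :=
    ModuleCat.ofHom (X := extModule φ S.X₂ 0) (r.hom.codRestrict K hr)
  have hF : (ShortComplex.mk p r' (by
      refine ModuleCat.hom_ext (LinearMap.ext fun e => Subtype.ext ?_)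
      exact hrp e)).ShortExact := by
    refine ModuleCat.shortComplex_shortExact _ ?_ ?_ ?_
    · intro x
      constructor
      · intro h
        exact Ext.contravariant_sequence_exact₂ hS Y x (congrArg Subtype.val h)
      · rintro ⟨e, rfl⟩
        exact Subtype.ext (hrp e)
    · have := hS.epi_g
      exact Ext.precomp_mk₀_injective_of_epi Y S.g
    · rintro ⟨x, hx⟩
      obtain ⟨e, he⟩ := Ext.contravariant_sequence_exact₁ hS Y x (add_zero 1) hx
      exact ⟨e, Subtype.ext he⟩
  have h₃' (j : ℕ) (hj : j + 1 < d) : LocalCohomologyVanishes I (extModule φ S.X₃ 1) j := by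
    refine (natCast_le_depthAt_iff _ _ (j + 1)).1 ?_ j (Nat.lt_succ_self j)
    have : ((j + 1 : ℕ) : ℕ∞) + 2 ≤ depthAt I (extModule φ S.X₃ 1) + 2 :=
      le_trans (by exact_mod_cast (by omega : j + 1 + 2 ≤ d + 1)) h₃
    exact (ENat.add_le_add_iff_right (by decide)).1 this
  rw [natCast_le_depthAt_iff] at h₁ h₂ ⊢
  intro i hi
  refine LocalCohomologyVanishes.of_shortExact₁ hF (h₂ i hi) fun j hj => ?_
  exact LocalCohomologyVanishes.of_shortExact₁ hK (h₁ j (by omega)) fun l hl => h₃' l (by omega)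

/-- The dimension shift `Ext^j(K, Y) ≅ Ext^{j+1}(M, Y)` for a short exact sequence
`0 ⟶ K ⟶ F ⟶ M ⟶ 0` such that `Ext^j(F, Y) = Ext^{j+1}(F, Y) = 0`. -/
def extModuleShiftIso {S : ShortComplex 𝒞} (hS : S.ShortExact) {j l : ℕ} (hl : 1 + j = l)
    (h : Subsingleton (Ext S.X₂ Y j)) (h' : Subsingleton (Ext S.X₂ Y l)) :
    extModule φ S.X₁ j ≅ extModule φ S.X₃ l :=
  LinearEquiv.toModuleIso (LinearEquiv.ofBijective (extPrecomp φ hS.extClass hl).hom (by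
    constructor
    · refine (injective_iff_map_eq_zero _).2 fun x hx => ?_
      obtain ⟨e, he⟩ := Ext.contravariant_sequence_exact₁ hS Y x hl hx
      rw [← he, h.elim e 0]
      exact Ext.comp_zero ..
    · intro x
      exact Ext.contravariant_sequence_exact₃ hS Y x (h'.elim _ _) hl))

/-- The class `Q` (finitely generated modules in the application) is closed under the chosen
syzygies, so the induction on `d` may replace `M` by its syzygy. The loss of one in `d` matches the
shift `Ext^j(K, Y) ≅ Ext^{j+1}(M, Y)`. -/
theorem natCast_le_depthAt_extModule_zero (I : Ideal A) (D : ℕ∞) (Q : 𝒞 → Prop)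
    (hQ : ∀ M, Q M → ∃ S : ShortComplex 𝒞, S.ShortExact ∧ S.X₃ = M ∧ Q S.X₁ ∧
      (∀ j, 1 ≤ j → Subsingleton (Ext S.X₂ Y j)) ∧ D ≤ depthAt I (homModule φ S.X₂))
    (d : ℕ) (hd : d ≤ D) (M : 𝒞) (hM : Q M)
    (h : ∀ j : ℕ, 1 ≤ j → (d : ℕ∞) ≤ depthAt I (extModule φ M j) + j + 1) :
    (d : ℕ∞) ≤ depthAt I (extModule φ M 0) := by
  induction d generalizing M with
  | zero => simp
  | succ d IH =>
    obtain ⟨S, hS, rfl, hK, hF, hD⟩ := hQ M hM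
    refine natCast_succ_le_depthAt_extModule_zero φ hS I d (hF 1 le_rfl) ?_ ?_ ?_
    · rw [← depthAt_eq_of_iso (homModuleIso φ S.X₂)]
      exact hd.trans hD
    · refine IH (le_trans (by exact_mod_cast d.le_succ) hd) _ hK fun j hj => ?_
      have h1 := h (1 + j) (by omega)
      rw [← depthAt_eq_of_iso (extModuleShiftIso φ hS rfl (hF j hj) (hF (1 + j) (by omega)))] at h1
      refine (ENat.add_le_add_iff_right (k := 1) (by decide)).1 ?_
      refine le_trans (by exact_mod_cast le_rfl) (h1.trans (le_of_eq ?_))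
      push_cast
      ring
    · have h1 := h 1 le_rfl
      rwa [Nat.cast_one, add_assoc, one_add_one_eq_two] at h1

end ExtModules

/-! ### The depth bound over a group algebra -/

section GroupAlgebra

open Abelian

variable {k : Type u} [Field k] {A : Type u} [CommRing A] [Algebra k A]
  {G : Type u} [Group G]
  {X : Type u} [AddCommGroup X] [Module k X] [Module A X] [IsScalarTower k A X]

/-- `Hom(kG^n, X)` is `X^n` by evaluation at the basis vectors. It is enough to write its identity
as a sum of maps factoring through `X`. -/
theorem depthAt_le_depthAt_homModule_free (ρ : Representation A G X) (I : Ideal A) (n : ℕ) :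
    depthAt I (ModuleCat.of A X) ≤ depthAt I (homModule (kGEnd k ρ)
      (ModuleCat.of (MonoidAlgebra k G) (Fin n → MonoidAlgebra k G))) := by
  classical
  let F := ModuleCat.of (MonoidAlgebra k G) (Fin n → MonoidAlgebra k G)
  let p (t : Fin n) : homModule (kGEnd k ρ) F →ₗ[A] X :=
    { toFun := fun f => (restrictRep k ρ).asModuleEquiv
        ((show F ⟶ kGModule k ρ from f).hom (Pi.single t 1))
      map_add' := fun f g => rfl
      map_smul' := fun a f => rfl }
  let q (t : Fin n) : X →ₗ[A] homModule (kGEnd k ρ) F :=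
    { toFun := fun x => (ModuleCat.ofHom
        ((LinearMap.toSpanSingleton _ _ ((restrictRep k ρ).asModuleEquiv.symm x)) ∘ₗ
          LinearMap.proj t) : F ⟶ kGModule k ρ)
      map_add' := fun x y => by
        refine ModuleCat.hom_ext (LinearMap.ext fun v => ?_)
        exact smul_add (v t) ((restrictRep k ρ).asModuleEquiv.symm x)
          ((restrictRep k ρ).asModuleEquiv.symm y)
      map_smul' := fun a x => by
        refine ModuleCat.hom_ext (LinearMap.ext fun v => ?_)
        exact ((kGMul k ρ a).map_smul (v t) ((restrictRep k ρ).asModuleEquiv.symm x)).symm }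
  have hpq (f : homModule (kGEnd k ρ) F) : ∑ t, q t (p t f) = f := by
    let ev (v : F) : homModule (kGEnd k ρ) F →+ (restrictRep k ρ).asModule :=
      { toFun := fun f => (show F ⟶ kGModule k ρ from f).hom v
        map_zero' := rfl
        map_add' := fun _ _ => rfl }
    refine ModuleCat.hom_ext (M := F) (N := kGModule k ρ) (LinearMap.ext fun v => ?_)
    change ev v _ = ev v f
    rw [map_sum]
    let f' : (Fin n → MonoidAlgebra k G) →ₗ[MonoidAlgebra k G] (restrictRep k ρ).asModule :=
      (show F ⟶ kGModule k ρ from f).hom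
    change ∑ t, v t • f' (Pi.single t 1) = f' v
    simp_rw [← map_smul]
    rw [← map_sum]
    congr 1
    ext t
    simp [Finset.sum_apply, Pi.single_apply]
  refine ENat.forall_natCast_le_iff_le.1 fun d h => ?_
  rw [natCast_le_depthAt_iff] at h ⊢
  exact fun i hi => LocalCohomologyVanishes.of_sum_eq_id
    (fun t => ModuleCat.ofHom (X := homModule (kGEnd k ρ) F) (p t))
    (fun t => ModuleCat.ofHom (Y := homModule (kGEnd k ρ) F) (q t))
    (by
      refine ModuleCat.hom_ext (LinearMap.ext fun f => ?_)
      rw [ModuleCat.hom_sum, LinearMap.sum_apply]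
      exact hpq f) fun _ => h i hi

theorem exists_shortExact_free [Finite G] (M : ModuleCat.{u} (MonoidAlgebra k G))
    [Module.Finite (MonoidAlgebra k G) M] :
    ∃ (S : ShortComplex (ModuleCat.{u} (MonoidAlgebra k G))) (n : ℕ), S.ShortExact ∧ S.X₃ = M ∧
      Module.Finite (MonoidAlgebra k G) S.X₁ ∧
      S.X₂ = ModuleCat.of (MonoidAlgebra k G) (Fin n → MonoidAlgebra k G) := by
  obtain ⟨n, f, hf⟩ := Module.Finite.exists_fin' (MonoidAlgebra k G) M
  have : IsNoetherianRing (MonoidAlgebra k G) := IsNoetherianRing.of_finite k _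
  refine ⟨ShortComplex.mk (ModuleCat.ofHom (LinearMap.ker f).subtype) (ModuleCat.ofHom f) ?_, n,
    ?_, rfl, ?_, rfl⟩
  · ext x; exact x.2
  · refine ModuleCat.shortComplex_shortExact _ ?_ Subtype.val_injective hf
    intro x
    exact ⟨fun h => ⟨⟨x, h⟩, rfl⟩, fun ⟨y, hy⟩ => hy ▸ y.2⟩
  · exact inferInstanceAs (Module.Finite _ (LinearMap.ker f))

/-- The depth of `Hom_{kG}(M, X)` is bounded below by the depths of `X` and of the groups
`Ext^j_{kG}(M, X)`. -/
theorem min_depthAt_le_depthAt_homKG [Finite G] {M : Type u} [AddCommGroup M] [Module k M]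
    [Module.Finite k M] (σ : Representation k G M) (ρ : Representation A G X) (I : Ideal A) :
    min (depthAt I (ModuleCat.of A X))
      (⨅ (j : ℕ) (_ : 1 ≤ j), depthAt I (extKG σ ρ j) + j + 1) ≤ depthAt I (homKG σ ρ) := by
  refine ENat.forall_natCast_le_iff_le.1 fun d h => ?_
  rw [le_min_iff] at h
  simp only [le_iInf_iff] at h
  have hM : Module.Finite (MonoidAlgebra k G) σ.asModule :=
    Module.Finite.of_restrictScalars_finite k _ _
  refine le_of_le_of_eq ?_ (depthAt_eq_of_iso (homModuleIso (kGEnd k ρ)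
    (ModuleCat.of (MonoidAlgebra k G) σ.asModule))).symm
  refine natCast_le_depthAt_extModule_zero (kGEnd k ρ) I _
    (fun M => Module.Finite (MonoidAlgebra k G) M) ?_ d h.1 _ hM h.2
  intro M hM
  obtain ⟨S, n, hS, h₃, h₁, h₂⟩ := exists_shortExact_free M
  refine ⟨S, hS, h₃, h₁, ?_, ?_⟩
  · rintro (_ | j) hj
    · omega
    · rw [h₂]
      exact Ext.subsingleton_of_projective _ _ _
  · rw [h₂]
    exact depthAt_le_depthAt_homModule_free ρ I n

end GroupAlgebra

/-! ### Relative projectivity and the transfer -/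

section EquivariantMaps

variable {k : Type u} [Field k] {A : Type u} [CommRing A] [Algebra k A]
  {G : Type u} [Group G] {M : Type u} [AddCommGroup M] [Module k M]
  {X : Type u} [AddCommGroup X] [Module k X] [Module A X] [IsScalarTower k A X]

/-- The `A`-module of `k`-linear `G`-equivariant maps from a `kG`-module to an `AG`-module. -/
def equivariantMaps (σ : Representation k G M) (ρ : Representation A G X) :
    Submodule A (M →ₗ[k] X) where
  carrier := {f | ∀ g m, f (σ g m) = ρ g (f m)}
  add_mem' {f f'} h h' g m := by
    rw [LinearMap.add_apply, LinearMap.add_apply, h, h', map_add]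
  zero_mem' g m := by simp
  smul_mem' a f h g m := by
    rw [LinearMap.smul_apply, LinearMap.smul_apply, h, map_smul]

theorem restrictRep_single_smul (ρ : Representation A G X) (g : G)
    (x : (restrictRep k ρ).asModule) :
    (restrictRep k ρ).asModuleEquiv (MonoidAlgebra.single g (1 : k) • x) =
      ρ g ((restrictRep k ρ).asModuleEquiv x) := by
  rw [Representation.single_smul, one_smul]
  rfl

/-- `Hom_{kG}(M, X)` is the module of `k`-linear `G`-equivariant maps. -/
def homKGEquiv (σ : Representation k G M) (ρ : Representation A G X) :
    homKG σ ρ ≃ₗ[A] equivariantMaps σ ρ where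
  toFun f :=
    ⟨(restrictRep k ρ).asModuleEquiv.toLinearMap ∘ₗ
      ((show ModuleCat.of (MonoidAlgebra k G) σ.asModule ⟶ kGModule k ρ from f).hom.restrictScalars
        k) ∘ₗ σ.asModuleEquiv.symm.toLinearMap, by
      intro g m
      let f' := (show ModuleCat.of (MonoidAlgebra k G) σ.asModule ⟶ kGModule k ρ from f).hom
      change (restrictRep k ρ).asModuleEquiv (f' (σ.asModuleEquiv.symm (σ g m))) =
        ρ g ((restrictRep k ρ).asModuleEquiv (f' (σ.asModuleEquiv.symm m)))
      rw [← restrictRep_single_smul, ← map_smul]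
      congr 2
      apply σ.asModuleEquiv.injective
      rw [Representation.single_smul, one_smul]
      rfl⟩
  invFun f := (ModuleCat.ofHom (MonoidAlgebra.equivariantOfLinearOfComm
    ((restrictRep k ρ).asModuleEquiv.symm.toLinearMap ∘ₗ f.1 ∘ₗ σ.asModuleEquiv.toLinearMap)
    (fun g m => by
      apply (restrictRep k ρ).asModuleEquiv.injective
      rw [restrictRep_single_smul, Representation.single_smul, one_smul]
      exact f.2 g (σ.asModuleEquiv m))) :
        ModuleCat.of (MonoidAlgebra k G) σ.asModule ⟶ kGModule k ρ)
  map_add' f f' := rfl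
  map_smul' a f := rfl
  left_inv f := rfl
  right_inv f := rfl

end EquivariantMaps

section Coinduced

variable {k : Type u} [Field k] {G : Type u} [Group G] {M : Type u} [AddCommGroup M] [Module k M]

/-- The functions `f : G → M` with `f (x h) = h⁻¹ f x` for `h ∈ P`. -/
def coinducedFunctions (σ : Representation k G M) (P : Subgroup G) : Submodule k (G → M) where
  carrier := {f | ∀ x, ∀ h ∈ P, f (x * h) = σ h⁻¹ (f x)}
  add_mem' {f f'} hf hf' x h hh := by
    rw [Pi.add_apply, Pi.add_apply, hf x h hh, hf' x h hh, map_add]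
  zero_mem' x h hh := by simp
  smul_mem' a f hf x h hh := by
    rw [Pi.smul_apply, Pi.smul_apply, hf x h hh, map_smul]

/-- `G` acts on coinduced functions by left translation. -/
def coinducedRep (σ : Representation k G M) (P : Subgroup G) :
    Representation k G (coinducedFunctions σ P) where
  toFun g :=
    { toFun := fun f => ⟨fun x => f.1 (g⁻¹ * x), fun x h hh => by
        change f.1 (g⁻¹ * (x * h)) = _
        rw [← mul_assoc]
        exact f.2 (g⁻¹ * x) h hh⟩
      map_add' := fun _ _ => rfl
      map_smul' := fun _ _ => rfl }
  map_one' := by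
    refine LinearMap.ext fun f => Subtype.ext (funext fun x => ?_)
    change f.1 (1⁻¹ * x) = f.1 x
    rw [inv_one, one_mul]
  map_mul' g h := by
    refine LinearMap.ext fun f => Subtype.ext (funext fun x => ?_)
    change f.1 ((g * h)⁻¹ * x) = f.1 (h⁻¹ * (g⁻¹ * x))
    rw [mul_inv_rev, mul_assoc]

theorem out_mk_smul_eq {N : Type*} (P : Subgroup G) (F : G → N)
    (hF : ∀ x, ∀ h ∈ P, F (x * h) = F x) (x : G) : F (Quotient.out (x : G ⧸ P)) = F x := by
  obtain ⟨h, hh⟩ := QuotientGroup.mk_out_eq_mul P x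
  rw [hh, hF x h h.2]

/-- Left translation by `g` permutes `G ⧸ P`, and right `P`-invariance makes the choice of coset
representatives irrelevant. -/
theorem sum_out_mul_left [Finite G] {N : Type*} [AddCommMonoid N] (P : Subgroup G) [Fintype (G ⧸ P)]
    (F : G → N) (hF : ∀ x, ∀ h ∈ P, F (x * h) = F x) (g : G) :
    ∑ q : G ⧸ P, F (g * q.out) = ∑ q : G ⧸ P, F q.out := by
  rw [← Equiv.sum_comp (MulAction.toPerm g) fun q : G ⧸ P => F q.out]
  refine Finset.sum_congr rfl fun q _ => ?_
  have : MulAction.toPerm g q = ((g * q.out : G) : G ⧸ P) := by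
    conv_lhs => rw [← QuotientGroup.out_eq' q]
    rfl
  rw [this, out_mk_smul_eq P F hF]

/-- Higman's criterion: a relatively `P`-projective module admits a `P`-equivariant endomorphism
whose transfer to `G` is the identity. -/
theorem IsRelativelyProjective.exists_transfer_eq_id [Finite G] {σ : Representation k G M}
    {P : Subgroup G} [Fintype (G ⧸ P)] (h : IsRelativelyProjective σ P) :
    ∃ θ : M →ₗ[k] M, (∀ x ∈ P, ∀ m, θ (σ x m) = σ x (θ m)) ∧
      ∀ m, ∑ q : G ⧸ P, σ q.out (θ (σ (q.out)⁻¹ m)) = m := by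
  classical
  have hmul (x y : G) (m : M) : σ (x * y) m = σ x (σ y m) := by rw [map_mul]; rfl
  have hinv (x : G) (m : M) : σ x (σ x⁻¹ m) = m := by
    rw [← hmul, mul_inv_cancel, map_one]; rfl
  -- This map onto `M` splits over `P`: send `m` to the function `x ↦ x⁻¹ m` on `P`, extended by
  -- zero. Relative projectivity then gives a splitting `t` over `G`.
  let π : coinducedFunctions σ P →ₗ[k] M :=
    { toFun := fun f => ∑ q : G ⧸ P, σ q.out (f.1 q.out)
      map_add' := fun f f' => by
        rw [← Finset.sum_add_distrib]
        exact Finset.sum_congr rfl fun q _ => map_add _ _ _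
      map_smul' := fun a f => by
        rw [RingHom.id_apply, Finset.smul_sum]
        exact Finset.sum_congr rfl fun q _ => map_smul _ _ _ }
  have hconst (f : coinducedFunctions σ P) (x : G) (h : G) (hh : h ∈ P) :
      σ (x * h) (f.1 (x * h)) = σ x (f.1 x) := by
    rw [f.2 x h hh, hmul, hinv]
  obtain ⟨t, ht, hπt⟩ := h (coinducedFunctions σ P) (coinducedRep σ P) π
    (by
      intro g f
      change ∑ q : G ⧸ P, σ q.out (f.1 (g⁻¹ * q.out)) = σ g (∑ q : G ⧸ P, σ q.out (f.1 q.out))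
      have := sum_out_mul_left P (fun x => σ g (σ x (f.1 x)))
        (fun x h hh => by rw [hconst f x h hh]) g⁻¹
      rw [map_sum, ← this]
      refine Finset.sum_congr rfl fun q _ => ?_
      rw [← hmul, mul_inv_cancel_left])
    (by
      let s (m : M) : coinducedFunctions σ P :=
        ⟨fun x => if x ∈ P then σ x⁻¹ m else 0, fun x h hh => by
          simp only [P.mul_mem_cancel_right hh]
          split_ifs
          · rw [mul_inv_rev, hmul]
          · rw [map_zero]⟩
      refine ⟨{ toFun := s, map_add' := ?_, map_smul' := ?_ }, ?_, ?_⟩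
      · intro m m'
        refine Subtype.ext (funext fun x => ?_)
        change (if x ∈ P then σ x⁻¹ (m + m') else 0) =
          (if x ∈ P then σ x⁻¹ m else 0) + (if x ∈ P then σ x⁻¹ m' else 0)
        split_ifs <;> simp
      · intro a m
        refine Subtype.ext (funext fun x => ?_)
        change (if x ∈ P then σ x⁻¹ (a • m) else 0) = a • (if x ∈ P then σ x⁻¹ m else 0)
        split_ifs <;> simp
      · intro g hg m
        refine Subtype.ext (funext fun x => ?_)
        change (if x ∈ P then σ x⁻¹ (σ g m) else 0) =
          if g⁻¹ * x ∈ P then σ (g⁻¹ * x)⁻¹ m else 0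
        rw [P.mul_mem_cancel_left (P.inv_mem hg)]
        split_ifs
        · rw [← hmul, mul_inv_rev, inv_inv]
        · rfl
      · refine LinearMap.ext fun m => ?_
        change ∑ q : G ⧸ P, σ q.out ((s m).1 q.out) = m
        rw [Finset.sum_eq_single ((1 : G) : G ⧸ P)]
        · rw [out_mk_smul_eq P (fun x => σ x ((s m).1 x)) (hconst (s m)) 1]
          change σ 1 (if (1 : G) ∈ P then σ 1⁻¹ m else 0) = m
          rw [if_pos P.one_mem, hinv]
        · intro q _ hq
          have : q.out ∉ P := fun hmem => hq (by
            rw [← QuotientGroup.out_eq' q]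
            exact (QuotientGroup.eq.2 (by simpa using hmem)).symm)
          change σ q.out (if q.out ∈ P then _ else 0) = 0
          rw [if_neg this, map_zero]
        · simp)
  have ht' (m : M) (x : G) : (t m).1 x = (t (σ x⁻¹ m)).1 1 := by
    rw [ht]
    change _ = (t m).1 (x⁻¹⁻¹ * 1)
    rw [inv_inv, mul_one]
  -- Take `θ m = (t m)(1)`. Equivariance gives `(t m)(x) = θ (x⁻¹ m)`, so `π ∘ t = id` says
  -- precisely that the transfer of `θ` is the identity.
  refine ⟨LinearMap.proj 1 ∘ₗ (coinducedFunctions σ P).subtype ∘ₗ t, ?_, ?_⟩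
  · intro x hx m
    change (t (σ x m)).1 1 = σ x ((t m).1 1)
    have h1 := (t m).2 1 x⁻¹ (P.inv_mem hx)
    rw [inv_inv, one_mul, ht', inv_inv] at h1
    exact h1
  · intro m
    refine Eq.trans ?_ (LinearMap.congr_fun hπt m)
    refine Finset.sum_congr rfl fun q _ => ?_
    exact congrArg _ (ht' m q.out).symm

variable {A : Type u} [CommRing A] [Algebra k A]
  {X : Type u} [AddCommGroup X] [Module k X] [Module A X] [IsScalarTower k A X]

/-- If `M` is relatively `P`-projective then `Hom_{kG}(M, X)` is a direct summand of
`Hom_{kP}(M, X)`. -/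
theorem depthAt_homKG_subgroup_le [Finite G] {σ : Representation k G M} {P : Subgroup G}
    (h : IsRelativelyProjective σ P) (ρ : Representation A G X) (I : Ideal A) :
    depthAt I (homKG (σ.comp P.subtype) (ρ.comp P.subtype)) ≤ depthAt I (homKG σ ρ) := by
  have : Fintype (G ⧸ P) := Fintype.ofFinite _
  obtain ⟨θ, hθ, hid⟩ := h.exists_transfer_eq_id
  have hmul (x y : G) (m : M) : σ (x * y) m = σ x (σ y m) := by rw [map_mul]; rfl
  have hmul' (x y : G) (m : X) : ρ (x * y) m = ρ x (ρ y m) := by rw [map_mul]; rfl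
  rw [depthAt_eq_of_iso (Y := homKG σ ρ) (homKGEquiv σ ρ).toModuleIso,
    depthAt_eq_of_iso (Y := homKG (σ.comp P.subtype) (ρ.comp P.subtype))
      (homKGEquiv (σ.comp P.subtype) (ρ.comp P.subtype)).toModuleIso]
  let p : equivariantMaps σ ρ →ₗ[A] equivariantMaps (σ.comp P.subtype) (ρ.comp P.subtype) :=
    Submodule.inclusion fun f hf g m => hf g m
  -- The retraction is the transfer of `f ∘ θ`. If `f` is already `G`-equivariant, it can be pulled
  -- out of the sum, leaving `f` applied to the transfer of `θ`, which is `f` itself.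
  let T (x : G) : (M →ₗ[k] X) →ₗ[A] (M →ₗ[k] X) :=
    { toFun := fun f => ((ρ x).restrictScalars k) ∘ₗ f ∘ₗ θ ∘ₗ σ x⁻¹
      map_add' := fun f f' => LinearMap.ext fun m => map_add (ρ x) _ _
      map_smul' := fun a f => LinearMap.ext fun m => map_smul (ρ x) _ _ }
  have hT (x : G) (f : M →ₗ[k] X) (m : M) : T x f m = ρ x (f (θ (σ x⁻¹ m))) := rfl
  have hTsum (f : M →ₗ[k] X) (m : M) :
      (∑ q : G ⧸ P, T q.out) f m = ∑ q : G ⧸ P, T q.out f m := by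
    rw [LinearMap.sum_apply, LinearMap.sum_apply]
  let q : equivariantMaps (σ.comp P.subtype) (ρ.comp P.subtype) →ₗ[A] equivariantMaps σ ρ :=
    LinearMap.codRestrict _ ((∑ q : G ⧸ P, T q.out) ∘ₗ Submodule.subtype _) (by
      intro f g m
      change (∑ q : G ⧸ P, T q.out) f.1 (σ g m) = ρ g ((∑ q : G ⧸ P, T q.out) f.1 m)
      rw [hTsum, hTsum, map_sum, ← sum_out_mul_left P (fun x => T x f.1 (σ g m)) ?_ g]
      · refine Finset.sum_congr rfl fun q _ => ?_
        rw [hT, hT, hmul', mul_inv_rev, hmul, ← hmul g⁻¹, inv_mul_cancel, map_one]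
        rfl
      · intro x h hh
        rw [hT, hT, mul_inv_rev, hmul, hθ _ (P.inv_mem hh), hmul']
        have := f.2 ⟨h, hh⟩ (σ h⁻¹ (θ (σ x⁻¹ (σ g m))))
        change f.1 (σ h _) = ρ h _ at this
        rw [← this, ← hmul, mul_inv_cancel, map_one]
        rfl)
  refine depthAt_le_of_retract (ModuleCat.ofHom p) (ModuleCat.ofHom q) ?_
  refine ModuleCat.hom_ext (LinearMap.ext fun f => Subtype.ext (LinearMap.ext fun m => ?_))
  change (∑ q : G ⧸ P, T q.out) f.1 m = f.1 m
  rw [hTsum]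
  conv_rhs => rw [← hid m, map_sum]
  exact Finset.sum_congr rfl fun q _ => (f.2 _ _).symm

end Coinduced

/-! ### Depth along semilinear isomorphisms -/

section Semilinear

variable {A B C : Type u} [CommRing A] [CommRing B] [CommRing C]

/-- A module isomorphic, along a ring homomorphism, to a restriction of scalars. -/
def restrictScalarsIso (f : A →+* C) {X : ModuleCat.{u} A} {Z : ModuleCat.{u} C} (e : X ≃+ Z)
    (he : ∀ (a : A) (x : X), e (a • x) = f a • e x) :
    X ≅ (ModuleCat.restrictScalars f).obj Z :=
  let e' : X ≃ₗ[A] (ModuleCat.restrictScalars f).obj Z := { e with map_smul' := he }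
  e'.toModuleIso

theorem depthAt_le_of_semilinear (f : A →+* C) (g : B →+* C) {I : Ideal A} (hI : I.FG)
    {J : Ideal B} (hIJ : I.map f ≤ (J.map g).radical) {X : ModuleCat.{u} A} {Y : ModuleCat.{u} B}
    {Z : ModuleCat.{u} C} (eX : X ≃+ Z) (hX : ∀ (a : A) (x : X), eX (a • x) = f a • eX x)
    (eY : Y ≃+ Z) (hY : ∀ (b : B) (y : Y), eY (b • y) = g b • eY y) :
    depthAt I X ≤ depthAt J Y := by
  rw [depthAt_eq_of_iso (restrictScalarsIso f eX hX), depthAt_eq_of_iso (restrictScalarsIso g eY hY)]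
  exact depthAt_restrictScalars_le f g hI hIJ Z

/-- Depth of a module `E` on which `y 0, …, y (m - 1)` is a regular sequence with a left inverse
of each `y i`, in terms of `E / (y) E` considered over another ring. -/
theorem depthAt_add_le_of_leftInverse (f : A →+* C) {I : Ideal A} (hI : I.FG) {J : Ideal C}
    (hIJ : I.map f ≤ J) {m : ℕ} (E : ModuleCat.{u} C) (Z : ModuleCat.{u} A)
    (y : Fin m → C) (hy : ∀ i, y i ∈ J) (ψ : Fin m → E →+ E) (hψ : ∀ i x, ψ i (y i • x) = x)
    (hψ' : ∀ i l x, i ≠ l → ψ i (y l • x) = y l • ψ i x)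
    (q : E →+ Z) (hqf : ∀ a x, q (f a • x) = a • q x) (hq : Function.Surjective q)
    (hker : ∀ x, q x = 0 ↔ ∃ w : Fin m → E, x = ∑ i, y i • w i) :
    (m : ℕ∞) + depthAt I Z ≤ depthAt J E := by
  let s : (Fin m → E) →ₗ[C] E := ∑ i, LinearMap.lsmul C E (y i) ∘ₗ LinearMap.proj i
  have hs (w : Fin m → E) : s w = ∑ i, y i • w i := by
    simp only [s, LinearMap.sum_apply]
    rfl
  have hmem (x : E) : x ∈ LinearMap.range s ↔ q x = 0 := by
    rw [hker]
    simp only [LinearMap.mem_range, hs, eq_comm]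
  let N := LinearMap.range s
  let q' : Z ≃+ E ⧸ N := by
    refine AddEquiv.symm (AddEquiv.ofBijective
      (QuotientAddGroup.lift N.toAddSubgroup q fun x hx => (hmem x).1 hx) ⟨?_, ?_⟩)
    · refine (injective_iff_map_eq_zero _).2 fun x hx => ?_
      obtain ⟨x, rfl⟩ := Submodule.Quotient.mk_surjective N x
      exact (Submodule.Quotient.mk_eq_zero N).2 ((hmem x).2 hx)
    · exact fun z => (hq z).imp' Submodule.Quotient.mk fun x hx => hx
  have hq' (x : E) : q' (q x) = Submodule.Quotient.mk x := by
    rw [← AddEquiv.eq_symm_apply]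
    rfl
  -- `Z` and `E ⧸ N` are the same group over different rings; change of rings with common algebra
  -- `C` compares them, since `I C ⊆ J`.
  have h1 : depthAt I Z ≤ depthAt J (ModuleCat.of C (E ⧸ N)) := by
    refine depthAt_le_of_semilinear f (RingHom.id C) hI ?_ (Z := ModuleCat.of C (E ⧸ N)) q' ?_
      (AddEquiv.refl _) fun _ _ => rfl
    · rw [Ideal.map_id]
      exact hIJ.trans Ideal.le_radical
    · intro a z
      obtain ⟨x, rfl⟩ := hq z
      rw [← hqf, hq', hq']
      rfl
  refine ENat.forall_natCast_le_iff_le.1 fun D hD => ?_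
  -- A finite bound for `Z` suffices to reach the given `D`; if the depth of `Z` is infinite, `d =
  -- D` will do.
  obtain ⟨d, hd, hD'⟩ : ∃ d : ℕ, (d : ℕ∞) ≤ depthAt I Z ∧ D ≤ m + d := by
    by_cases htop : depthAt I Z = ⊤
    · exact ⟨D, by simp [htop], by omega⟩
    · lift depthAt I Z to ℕ using htop with d
      exact ⟨d, le_rfl, by exact_mod_cast hD⟩
  refine le_trans (by exact_mod_cast hD') (natCast_le_depthAt_of_leftInverse (d := d) E (E ⧸ N) y hy
    ψ hψ hψ' N.mkQ N.mkQ_surjective (fun x => ?_) (hd.trans h1))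
  rw [Submodule.mkQ_apply, Submodule.Quotient.mk_eq_zero, hmem, hker]

end Semilinear

/-! ### Equivariant operators acting on Ext -/

section ExtFunctoriality

open Abelian

variable {k : Type u} [Field k] {G : Type u} [Group G]
  {M : Type u} [AddCommGroup M] [Module k M] (σ : Representation k G M) (j : ℕ)
  {A : Type u} [CommRing A] [Algebra k A]
  {X : Type u} [AddCommGroup X] [Module k X] [Module A X] [IsScalarTower k A X]
  {A' : Type u} [CommRing A'] [Algebra k A']
  {X' : Type u} [AddCommGroup X'] [Module k X'] [Module A' X'] [IsScalarTower k A' X']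
  {A'' : Type u} [CommRing A''] [Algebra k A'']
  {X'' : Type u} [AddCommGroup X''] [Module k X''] [Module A'' X''] [IsScalarTower k A'' X'']
  {ρ : Representation A G X} {ρ' : Representation A' G X'} {ρ'' : Representation A'' G X''}

/-- A `k`-linear `G`-equivariant map as a homomorphism of `kG`-modules. -/
def kGHom (F : X →ₗ[k] X') (hF : ∀ g x, F (ρ g x) = ρ' g (F x)) :
    kGModule k ρ ⟶ kGModule k ρ' :=
  ModuleCat.ofHom (MonoidAlgebra.equivariantOfLinearOfComm
    ((restrictRep k ρ').asModuleEquiv.symm.toLinearMap ∘ₗ F ∘ₗ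
      (restrictRep k ρ).asModuleEquiv.toLinearMap)
    (fun g x => by
      apply (restrictRep k ρ').asModuleEquiv.injective
      rw [restrictRep_single_smul]
      change F ((restrictRep k ρ).asModuleEquiv (MonoidAlgebra.single g (1 : k) • x)) = _
      rw [restrictRep_single_smul]
      exact hF g ((restrictRep k ρ).asModuleEquiv x)))

/-- The map on `Ext^j_{kG}(M, -)` induced by a `k`-linear `G`-equivariant map. -/
def extMap (F : X →ₗ[k] X') (hF : ∀ g x, F (ρ g x) = ρ' g (F x)) :
    extKG σ ρ j →+ extKG σ ρ' j :=
  (Ext.mk₀ (kGHom F hF)).postcomp (ModuleCat.of (MonoidAlgebra k G) σ.asModule) (add_zero j)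

variable {σ j}

theorem extMap_extMap (F : X →ₗ[k] X') (hF : ∀ g x, F (ρ g x) = ρ' g (F x))
    (F' : X' →ₗ[k] X'') (hF' : ∀ g x, F' (ρ' g x) = ρ'' g (F' x)) (e : extKG σ ρ j) :
    extMap σ j F' hF' (extMap σ j F hF e) =
      extMap (ρ := ρ) (ρ' := ρ'') σ j (F' ∘ₗ F) (fun g x => by
        rw [LinearMap.comp_apply, LinearMap.comp_apply, hF, hF']) e := by
  let e' : Ext (ModuleCat.of (MonoidAlgebra k G) σ.asModule) (kGModule k ρ) j := e
  change (e'.comp (Ext.mk₀ (kGHom F hF)) (add_zero j)).comp (Ext.mk₀ (kGHom F' hF')) (add_zero j) =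
    e'.comp (Ext.mk₀ (kGHom (F' ∘ₗ F) _)) (add_zero j)
  rw [Ext.comp_assoc_of_third_deg_zero, Ext.mk₀_comp_mk₀]
  rfl

theorem extMap_eq_self (F : X →ₗ[k] X) (hF : ∀ g x, F (ρ g x) = ρ g (F x)) (h : ∀ x, F x = x)
    (e : extKG σ ρ j) : extMap σ j F hF e = e := by
  obtain rfl : F = LinearMap.id := LinearMap.ext h
  exact Ext.comp_mk₀_id _

theorem extMap_congr {F F' : X →ₗ[k] X'} {hF : ∀ g x, F (ρ g x) = ρ' g (F x)}
    {hF' : ∀ g x, F' (ρ g x) = ρ' g (F' x)} (h : ∀ x, F x = F' x) (e : extKG σ ρ j) :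
    extMap σ j F hF e = extMap σ j F' hF' e := by
  obtain rfl : F = F' := LinearMap.ext h
  rfl

theorem extMap_eq_zero {F : X →ₗ[k] X'} {hF : ∀ g x, F (ρ g x) = ρ' g (F x)} (h : ∀ x, F x = 0)
    (e : extKG σ ρ j) : extMap σ j F hF e = 0 := by
  obtain rfl : F = 0 := LinearMap.ext h
  have : kGHom (ρ := ρ) (ρ' := ρ') (0 : X →ₗ[k] X') hF = 0 := rfl
  let e' : Ext (ModuleCat.of (MonoidAlgebra k G) σ.asModule) (kGModule k ρ) j := e
  change e'.comp (Ext.mk₀ (kGHom 0 hF)) (add_zero j) = 0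
  rw [this, Ext.mk₀_zero, Ext.comp_zero]

theorem extMap_eq_add_sum {ι : Type*} [Fintype ι] {F F₀ : X →ₗ[k] X'}
    (hF : ∀ g x, F (ρ g x) = ρ' g (F x)) (hF₀ : ∀ g x, F₀ (ρ g x) = ρ' g (F₀ x))
    {F' : ι → X →ₗ[k] X'} (hF' : ∀ t g x, F' t (ρ g x) = ρ' g (F' t x))
    (h : ∀ x, F x = F₀ x + ∑ t, F' t x) (e : extKG σ ρ j) :
    extMap σ j F hF e = extMap σ j F₀ hF₀ e + ∑ t, extMap σ j (F' t) (hF' t) e := by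
  have : kGHom F hF = kGHom F₀ hF₀ + ∑ t, kGHom (F' t) (hF' t) := by
    refine ModuleCat.hom_ext (LinearMap.ext fun x => ?_)
    rw [ModuleCat.hom_add, LinearMap.add_apply, ModuleCat.hom_sum, LinearMap.sum_apply]
    exact h x
  let e' : Ext (ModuleCat.of (MonoidAlgebra k G) σ.asModule) (kGModule k ρ) j := e
  change e'.comp (Ext.mk₀ (kGHom F hF)) (add_zero j) =
    e'.comp (Ext.mk₀ (kGHom F₀ hF₀)) (add_zero j) +
      ∑ t, e'.comp (Ext.mk₀ (kGHom (F' t) (hF' t))) (add_zero j)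
  rw [this, Ext.mk₀_add, Ext.comp_add, Ext.mk₀_sum, Ext.comp_sum]

variable (k X) in
/-- Multiplication by `a : A` as a `k`-linear map. -/
def kMul (a : A) : X →ₗ[k] X := (LinearMap.lsmul A X a).restrictScalars k

theorem kMul_equivariant (ρ : Representation A G X) (a : A) (g : G) (x : X) :
    kMul k X a (ρ g x) = ρ g (kMul k X a x) :=
  (map_smul (ρ g) a x).symm

theorem smul_eq_extMap (a : A) (e : extKG σ ρ j) :
    a • e = extMap (ρ := ρ) (ρ' := ρ) σ j (kMul k X a) (kMul_equivariant ρ a) e := rfl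

/-- A `k`-linear equivariant map that is semilinear over `f : A → A'` induces an `f`-semilinear
map on `Ext`. -/
theorem extMap_smul (f : A → A') (F : X →ₗ[k] X') (hF : ∀ g x, F (ρ g x) = ρ' g (F x))
    (hf : ∀ a x, F (a • x) = f a • F x) (a : A) (e : extKG σ ρ j) :
    extMap σ j F hF (a • e) = f a • extMap σ j F hF e := by
  rw [smul_eq_extMap, smul_eq_extMap, extMap_extMap, extMap_extMap]
  exact extMap_congr (fun x => hf a x) e

/-- A `k`-linear equivariant bijection induces an additive equivalence on `Ext`. -/
def extMapEquiv (F : X ≃ₗ[k] X') (hF : ∀ g x, F (ρ g x) = ρ' g (F x)) :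
    extKG σ ρ j ≃+ extKG σ ρ' j where
  __ := extMap σ j F.toLinearMap hF
  invFun := extMap σ j F.symm.toLinearMap fun g x => by
    apply F.injective
    change F (F.symm _) = F (ρ g (F.symm x))
    rw [hF, F.apply_symm_apply, F.apply_symm_apply]
  left_inv e := by
    refine (extMap_extMap _ _ _ _ e).trans ?_
    exact extMap_eq_self _ _ (fun x => F.symm_apply_apply x) e
  right_inv e := by
    refine (extMap_extMap _ _ _ _ e).trans ?_
    exact extMap_eq_self _ _ (fun x => F.apply_symm_apply x) e

/-- Change of rings for the depth of `Ext^j_{kG}(M, X)`. -/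
theorem depthAt_extKG_le_of_semilinear (σ : Representation k G M) (j : ℕ) (g : A' →+* A)
    {I : Ideal A} (hI : I.FG) {J : Ideal A'} (hIJ : I ≤ (J.map g).radical)
    (F : X' ≃ₗ[k] X) (hF : ∀ h x, F (ρ' h x) = ρ h (F x)) (hg : ∀ b x, F (b • x) = g b • F x) :
    depthAt I (extKG σ ρ j) ≤ depthAt J (extKG σ ρ' j) :=
  depthAt_le_of_semilinear (RingHom.id A) g hI (by rwa [Ideal.map_id]) (AddEquiv.refl _)
    (fun _ _ => rfl) (extMapEquiv F hF) (fun b e => extMap_smul g F.toLinearMap hF hg b e)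

/-- Depth of `Ext^j_{kG}(M, X)` if `y 0, …, y (m - 1)` act on `X` with equivariant left inverses
`ψ i`, and `X'` is an equivariant complement of `(y) X` in `X`. -/
theorem depthAt_extKG_add_le (σ : Representation k G M) (j : ℕ) (f : A' →+* A) {I : Ideal A'}
    (hI : I.FG) {J : Ideal A} (hIJ : I.map f ≤ J) {m : ℕ} (y : Fin m → A) (hy : ∀ i, y i ∈ J)
    (ψ : Fin m → X →ₗ[k] X) (hψG : ∀ i g x, ψ i (ρ g x) = ρ g (ψ i x))
    (hψ : ∀ i x, ψ i (y i • x) = x) (hψ' : ∀ i l x, i ≠ l → ψ i (y l • x) = y l • ψ i x)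
    (q : X →ₗ[k] X') (hqG : ∀ g x, q (ρ g x) = ρ' g (q x)) (hqf : ∀ a x, q (f a • x) = a • q x)
    (s : X' →ₗ[k] X) (hsG : ∀ g x, s (ρ' g x) = ρ g (s x)) (hqs : ∀ x, q (s x) = x)
    (hqy : ∀ i x, q (y i • x) = 0)
    (χ : Fin m → X →ₗ[k] X) (hχG : ∀ i g x, χ i (ρ g x) = ρ g (χ i x))
    (hχ : ∀ x, x = s (q x) + ∑ i, y i • χ i x) :
    (m : ℕ∞) + depthAt I (extKG σ ρ' j) ≤ depthAt J (extKG σ ρ j) := by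
  refine depthAt_add_le_of_leftInverse f hI hIJ _ _ y hy (fun i => extMap σ j (ψ i) (hψG i)) ?_ ?_
    (extMap σ j q hqG) ?_ ?_ ?_
  · intro i e
    rw [smul_eq_extMap, extMap_extMap]
    exact extMap_eq_self _ _ (hψ i) e
  · intro i l e hil
    rw [smul_eq_extMap, smul_eq_extMap, extMap_extMap, extMap_extMap]
    exact extMap_congr (fun x => hψ' i l x hil) e
  · intro a e
    rw [smul_eq_extMap, smul_eq_extMap, extMap_extMap, extMap_extMap]
    exact extMap_congr (fun x => hqf a x) e
  · intro e
    refine ⟨extMap σ j s hsG e, ?_⟩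
    rw [extMap_extMap]
    exact extMap_eq_self _ _ hqs e
  · intro e
    constructor
    · intro he
      refine ⟨fun i => extMap σ j (χ i) (hχG i) e, ?_⟩
      have hsq (g : G) (x : X) : (s ∘ₗ q) (ρ g x) = ρ g ((s ∘ₗ q) x) := by
        rw [LinearMap.comp_apply, LinearMap.comp_apply, hqG, hsG]
      have hyχ (i : Fin m) (g : G) (x : X) :
          (kMul k X (y i) ∘ₗ χ i) (ρ g x) = ρ g ((kMul k X (y i) ∘ₗ χ i) x) := by
        rw [LinearMap.comp_apply, LinearMap.comp_apply, hχG, kMul_equivariant]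
      -- Ext is additive in the second variable, so `id = s q + ∑ y_i χ_i` persists on Ext. A class
      -- killed by `q` therefore lies in the span of the `y_i`.
      have h1 := extMap_eq_add_sum (ρ := ρ) (ρ' := ρ) (σ := σ) (j := j)
        (F := LinearMap.id) (fun _ _ => rfl) hsq hyχ hχ e
      rw [extMap_eq_self _ _ (fun _ => rfl), ← extMap_extMap q hqG s hsG, he, map_zero,
        zero_add] at h1
      refine h1.trans (Finset.sum_congr rfl fun i _ => ?_)
      rw [smul_eq_extMap, extMap_extMap]
    · rintro ⟨w, rfl⟩
      rw [map_sum]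
      refine Finset.sum_eq_zero fun i _ => ?_
      rw [smul_eq_extMap, extMap_extMap]
      exact extMap_eq_zero (hqy i) _

end ExtFunctoriality

/-! ### Division operators on polynomial rings -/

section MvPolynomialOperators

open MvPolynomial

variable (k : Type u) [Field k] {m : ℕ}

/-- Division by the variable `X i`, discarding the monomials that are not divisible by it. -/
def divX (i : Fin m) : MvPolynomial (Fin m) k →ₗ[k] MvPolynomial (Fin m) k where
  toFun p := p.divMonomial (Finsupp.single i 1)
  map_add' p q := add_divMonomial p q _
  map_smul' a p := by
    ext s
    simp [coeff_divMonomial]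

variable {k}

theorem divX_X_mul (i : Fin m) (p : MvPolynomial (Fin m) k) : divX k i (X i * p) = p :=
  X_mul_divMonomial i p

theorem divX_X_mul_of_ne {i l : Fin m} (h : i ≠ l) (p : MvPolynomial (Fin m) k) :
    divX k i (X l * p) = X l * divX k i p := by
  ext s
  change coeff s ((X l * p).divMonomial _) = coeff s (X l * p.divMonomial _)
  rw [coeff_divMonomial, coeff_X_mul', coeff_X_mul']
  have h1 : l ∈ (Finsupp.single i 1 + s).support ↔ l ∈ s.support := by
    simp [h]
  simp only [h1]
  split_ifs with hl
  · rw [coeff_divMonomial, add_tsub_assoc_of_le]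
    rw [Finsupp.single_le_iff]
    exact Nat.one_le_iff_ne_zero.2 (Finsupp.mem_support_iff.1 hl)
  · rfl

theorem constantCoeff_eq_zero_iff (p : MvPolynomial (Fin m) k) :
    constantCoeff p = 0 ↔ ∃ w : Fin m → MvPolynomial (Fin m) k, p = ∑ i, X i * w i := by
  constructor
  · intro h
    have : p ∈ idealOfVars (Fin m) k ^ 1 := by
      rw [mem_pow_idealOfVars_iff']
      intro s hs
      have : s = 0 := (Finsupp.degree_eq_zero_iff s).1 (by simpa using hs)
      rw [this]
      exact h
    rw [pow_one, idealOfVars, Ideal.mem_span_range_iff_exists_fun] at this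
    obtain ⟨c, hc⟩ := this
    exact ⟨c, by simp_rw [mul_comm (X _)]; exact hc.symm⟩
  · rintro ⟨w, rfl⟩
    simp

variable (k m) in
-- The map `w ↦ ∑ X_i w_i` onto the polynomials without constant term has a `k`-linear section.
-- Linearity is what allows the `χ i` to be tensored with `U` and then applied to Ext.
theorem exists_linearMap_sub_constantCoeff :
    ∃ χ : Fin m → MvPolynomial (Fin m) k →ₗ[k] MvPolynomial (Fin m) k,
      ∀ p, p = C (constantCoeff p) + ∑ i, X i * χ i p := by
  let s : (Fin m → MvPolynomial (Fin m) k) →ₗ[k] MvPolynomial (Fin m) k :=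
    ∑ i, LinearMap.mulLeft k (X i) ∘ₗ LinearMap.proj i
  have hs (w) : s w = ∑ i, X i * w i := by simp [s]
  let c : MvPolynomial (Fin m) k →ₗ[k] k :=
    { toFun := constantCoeff, map_add' := map_add _, map_smul' := by simp }
  let K := LinearMap.ker c
  have hK (w) : s w ∈ K := (constantCoeff_eq_zero_iff _).2 ⟨w, hs w⟩
  obtain ⟨t, ht⟩ := (s.codRestrict K hK).exists_rightInverse_of_surjective (by
    rw [LinearMap.range_eq_top]
    rintro ⟨p, hp⟩
    obtain ⟨w, hw⟩ := (constantCoeff_eq_zero_iff p).1 hp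
    exact ⟨w, Subtype.ext ((hs w).trans hw.symm)⟩)
  let D : MvPolynomial (Fin m) k →ₗ[k] MvPolynomial (Fin m) k :=
    LinearMap.id - Algebra.linearMap k (MvPolynomial (Fin m) k) ∘ₗ c
  have hP (p : MvPolynomial (Fin m) k) : D p ∈ K := by
    change constantCoeff (p - C (constantCoeff p)) = 0
    rw [map_sub, constantCoeff_C, sub_self]
  let χ := t ∘ₗ LinearMap.codRestrict K D hP
  refine ⟨fun i => LinearMap.proj i ∘ₗ χ, fun p => ?_⟩
  have h1 : s (χ p) = p - C (constantCoeff p) :=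
    congrArg Subtype.val (LinearMap.congr_fun ht ⟨_, hP p⟩)
  rw [hs] at h1
  exact (add_eq_of_eq_sub' h1).symm

theorem le_depthAt_mvPolynomial :
    (m : ℕ∞) ≤ depthAt (idealOfVars (Fin m) k) (ModuleCat.of _ (MvPolynomial (Fin m) k)) := by
  let N : Ideal (MvPolynomial (Fin m) k) := idealOfVars (Fin m) k
  refine natCast_le_depthAt_of_leftInverse (d := 0) (MvPolynomial (Fin m) k)
    (MvPolynomial (Fin m) k ⧸ N) (fun i => X i)
    (fun i => Ideal.subset_span ⟨i, rfl⟩) (fun i => (divX k i).toAddMonoidHom)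
    (fun i p => divX_X_mul i p) (fun i l p h => divX_X_mul_of_ne h p) N.mkQ N.mkQ_surjective ?_ ?_
  · intro p
    rw [Submodule.mkQ_apply, Submodule.Quotient.mk_eq_zero, Ideal.mem_span_range_iff_exists_fun]
    refine exists_congr fun w => ?_
    simp_rw [mul_comm (w _), eq_comm (b := p)]
    rfl
  · simp

end MvPolynomialOperators

/-! ### The grading of `k[V]` and graded maximal ideals -/

section PolyGrading

variable {k : Type u} [Field k] {V : Type u} [AddCommGroup V] [Module k V]

theorem mul_mem_polyGrading {d e : ℕ} {x y : PolyRing k V} (hx : x ∈ polyGrading k V d)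
    (hy : y ∈ polyGrading k V e) : x * y ∈ polyGrading k V (d + e) := by
  rw [polyGrading, pow_add]
  exact Submodule.mul_mem_mul hx hy

theorem pow_mem_polyGrading {d : ℕ} {x : PolyRing k V} (hx : x ∈ polyGrading k V d) (n : ℕ) :
    x ^ n ∈ polyGrading k V (d * n) := by
  rw [polyGrading, pow_mul]
  exact Submodule.pow_mem_pow _ hx n

theorem mem_polyGrading_zero_iff {x : PolyRing k V} :
    x ∈ polyGrading k V 0 ↔ ∃ c : k, algebraMap k _ c = x := by
  rw [polyGrading, pow_zero, Submodule.mem_one]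

theorem algebraMapInv_of_mem_polyGrading {d : ℕ} (hd : d ≠ 0) {x : PolyRing k V}
    (hx : x ∈ polyGrading k V d) : SymmetricAlgebra.algebraMapInv (R := k) x = 0 := by
  obtain ⟨d, rfl⟩ := Nat.exists_eq_succ_of_ne_zero hd
  rw [polyGrading, pow_succ] at hx
  induction hx using Submodule.mul_induction_on' with
  | mem_mul_mem a _ b hb =>
    obtain ⟨b, rfl⟩ := hb
    rw [map_mul, SymmetricAlgebra.algebraMapInv_ι, mul_zero]
  | add a _ b _ ha hb => rw [map_add, ha, hb, add_zero]

/-- The ideal generated by `r` is homogeneous, and proper because the augmentation of `k[V]` kills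
`r` but not 1. -/
theorem mem_gradedMaximalIdeal {R : Subalgebra k (PolyRing k V)} {d : ℕ} (hd : d ≠ 0) {r : R}
    (hr : (r : PolyRing k V) ∈ polyGrading k V d) :
    r ∈ gradedMaximalIdeal (polyGrading k V) R := by
  refine Ideal.mem_sSup_of_mem (S := {I : Ideal R | I ≠ ⊤ ∧ IsHomogeneousIdeal _ R I})
    (s := Ideal.span {r}) ⟨?_, ?_⟩ (Ideal.mem_span_singleton_self r)
  · intro h
    have h1 : (1 : R) ∈ Ideal.span {r} := h ▸ Submodule.mem_top
    obtain ⟨a, ha⟩ := Ideal.mem_span_singleton'.1 h1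
    have h2 := congrArg (fun x : R =>
      SymmetricAlgebra.algebraMapInv (R := k) (x : PolyRing k V)) ha
    simp [algebraMapInv_of_mem_polyGrading hd hr] at h2
  · refine le_antisymm ?_ (Ideal.span_le.2 fun x hx => hx.1)
    refine Ideal.span_le.2 ?_
    rintro x rfl
    exact Ideal.subset_span ⟨Ideal.mem_span_singleton_self x, d, hr⟩

/-- A homogeneous element of degree 0 is a scalar, hence zero or a unit, so a proper homogeneous
ideal is generated by its elements of positive degree. -/
theorem gradedMaximalIdeal_le_span (R : Subalgebra k (PolyRing k V)) :
    gradedMaximalIdeal (polyGrading k V) R ≤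
      Ideal.span {r : R | ∃ d ≠ 0, (r : PolyRing k V) ∈ polyGrading k V d} := by
  refine sSup_le ?_
  rintro I ⟨hI, hIh⟩
  rw [hIh]
  refine Ideal.span_le.2 ?_
  rintro r ⟨hrI, d, hr⟩
  by_cases hd : d = 0
  · subst hd
    obtain ⟨c, hc⟩ := mem_polyGrading_zero_iff.1 hr
    have hc' : algebraMap k R c = r := Subtype.ext hc
    by_cases hc0 : c = 0
    · rw [← hc', hc0, map_zero]
      exact Ideal.zero_mem _
    · refine absurd (Ideal.eq_top_of_isUnit_mem I hrI ?_) hI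
      rw [← hc']
      exact (IsUnit.mk0 c hc0).map (algebraMap k R)
  · exact Ideal.subset_span ⟨d, hd, hr⟩

end PolyGrading

/-! ### Integrality over graded subalgebras; the depth of `k[V]` -/

section PolyRing

open MvPolynomial

variable (k : Type u) [Field k] (V : Type u) [AddCommGroup V] [Module k V] [Module.Finite k V]

/-- Coordinates on `V` identify `k[V]` with a polynomial ring. -/
def polyRingEquiv : PolyRing k V ≃ₐ[k] MvPolynomial (Fin (Module.finrank k V)) k :=
  SymmetricAlgebra.equivMvPolynomial
    (Module.finBasisOfFinrankEq k (Module.Dual k V) Subspace.dual_finrank_eq)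

variable {k V}

theorem polyRingEquiv_ι_isHomogeneous (x : Module.Dual k V) :
    (polyRingEquiv k V (SymmetricAlgebra.ι k _ x)).IsHomogeneous 1 := by
  let b := Module.finBasisOfFinrankEq k (Module.Dual k V) Subspace.dual_finrank_eq
  rw [← mem_homogeneousSubmodule, ← b.sum_repr x]
  simp only [map_sum, map_smul]
  refine Submodule.sum_mem _ fun i _ => Submodule.smul_mem _ _ ?_
  rw [polyRingEquiv, SymmetricAlgebra.equivMvPolynomial_ι_apply]
  exact isHomogeneous_X k i

theorem isHomogeneous_of_mem_polyGrading {d : ℕ} {x : PolyRing k V} (hx : x ∈ polyGrading k V d) :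
    (polyRingEquiv k V x).IsHomogeneous d := by
  induction hx using Submodule.pow_induction_on_left' with
  | algebraMap r =>
    rw [AlgEquiv.commutes]
    exact isHomogeneous_C _ r
  | add x y i _ _ hx hy =>
    rw [map_add]
    exact hx.add hy
  | mem_mul y hy i x _ hx =>
    obtain ⟨y, rfl⟩ := hy
    rw [map_mul, Nat.succ_eq_one_add]
    exact (polyRingEquiv_ι_isHomogeneous y).mul hx

variable (k V) in
/-- The homogeneous component of degree `d` of an element of `k[V]`. -/
def polyComponent (d : ℕ) : PolyRing k V →ₗ[k] PolyRing k V :=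
  (polyRingEquiv k V).symm.toLinearMap ∘ₗ homogeneousComponent d ∘ₗ
    (polyRingEquiv k V).toLinearMap

theorem polyComponent_of_mem {d e : ℕ} {x : PolyRing k V} (hx : x ∈ polyGrading k V d) :
    polyComponent k V e x = if d = e then x else 0 := by
  change (polyRingEquiv k V).symm (homogeneousComponent e (polyRingEquiv k V x)) = _
  rw [homogeneousComponent_of_mem (isHomogeneous_of_mem_polyGrading hx)]
  by_cases h : d = e
  · rw [if_pos h, if_pos h.symm, AlgEquiv.symm_apply_apply]
  · rw [if_neg h, if_neg (Ne.symm h), map_zero]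

/-- All assertions are linear in `r`, and `R` is the sum of its homogeneous parts, so it suffices to
check them for homogeneous `r`. -/
theorem polyComponent_mul_of_isGradedSubalgebra {R : Subalgebra k (PolyRing k V)}
    (hR : IsGradedSubalgebra (polyGrading k V) R) {r : PolyRing k V} (hr : r ∈ R) (d : ℕ) :
    (polyComponent k V d r ∈ R ∧ polyComponent k V d r ∈ polyGrading k V d) ∧
      ∀ (e : ℕ) (x : PolyRing k V), x ∈ polyGrading k V e →
        polyComponent k V (d + e) (r * x) = polyComponent k V d r * x := by
  have hr' : r ∈ ⨆ i, Subalgebra.toSubmodule R ⊓ polyGrading k V i := by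
    rw [← hR]
    exact hr
  clear hr
  induction hr' using Submodule.iSup_induction' with
  | mem i r hri =>
    rw [polyComponent_of_mem hri.2]
    refine ⟨?_, fun e x hx => ?_⟩
    · split_ifs with h
      · exact ⟨hri.1, h ▸ hri.2⟩
      · exact ⟨R.zero_mem, Submodule.zero_mem _⟩
    · rw [polyComponent_of_mem (mul_mem_polyGrading hri.2 hx)]
      split_ifs <;> first | rfl | omega | simp
  | zero => simp
  | add r s hr hs ihr ihs =>
    obtain ⟨⟨h1, h2⟩, h3⟩ := ihr
    obtain ⟨⟨h1', h2'⟩, h3'⟩ := ihs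
    refine ⟨⟨?_, ?_⟩, fun e x hx => ?_⟩
    · rw [map_add]; exact R.add_mem h1 h1'
    · rw [map_add]; exact Submodule.add_mem _ h2 h2'
    · rw [add_mul, map_add, map_add, h3 e x hx, h3' e x hx, add_mul]

/-- A homogeneous element of positive degree which is integral over a graded subalgebra `R`
satisfies an equation of integral dependence with coefficients in the maximal ideal of `R`. -/
theorem exists_pow_eq_sum_of_isIntegral {R : Subalgebra k (PolyRing k V)}
    (hR : IsGradedSubalgebra (polyGrading k V) R) {e : ℕ} (he : e ≠ 0) {x : PolyRing k V}
    (hx : x ∈ polyGrading k V e) (hint : IsIntegral R x) :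
    ∃ (N : ℕ) (r : ℕ → R), (∀ j < N, r j ∈ gradedMaximalIdeal (polyGrading k V) R) ∧
      x ^ N = ∑ j ∈ Finset.range N, (r j : PolyRing k V) * x ^ j := by
  obtain ⟨p, hp, hpx⟩ := hint
  let N := p.natDegree
  have hc (j : ℕ) := polyComponent_mul_of_isGradedSubalgebra hR (p.coeff j).2 (e * (N - j))
  let c (j : ℕ) : R := ⟨_, (hc j).1.1⟩
  have h0 : ∑ j ∈ Finset.range (N + 1), (p.coeff j : PolyRing k V) * x ^ j = 0 := by
    rw [← hpx, Polynomial.eval₂_eq_sum_range]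
    rfl
  -- Take the component of degree `e * N` of the integral equation. The new coefficient of `x ^ j`
  -- has degree `e * (N - j)`, positive for `j < N`, while the leading coefficient remains 1.
  have h1 : ∑ j ∈ Finset.range (N + 1), (c j : PolyRing k V) * x ^ j = 0 := by
    rw [← map_zero (polyComponent k V (e * N)), ← h0, map_sum]
    refine Finset.sum_congr rfl fun j hj => ?_
    rw [← (hc j).2 (e * j) (x ^ j) (pow_mem_polyGrading hx j), ← mul_add,
      Nat.sub_add_cancel (Nat.lt_succ_iff.1 (Finset.mem_range.1 hj))]
  have hcN : (c N : PolyRing k V) = 1 := by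
    change polyComponent k V (e * (N - N)) (p.coeff N : PolyRing k V) = 1
    rw [hp.coeff_natDegree, Nat.sub_self, mul_zero]
    exact (polyComponent_of_mem (d := 0) (mem_polyGrading_zero_iff.2 ⟨1, map_one _⟩)).trans
      (if_pos rfl)
  refine ⟨N, fun j => -c j, fun j hj => ?_, ?_⟩
  · refine (gradedMaximalIdeal (polyGrading k V) R).neg_mem ?_
    exact mem_gradedMaximalIdeal (mul_ne_zero he (by omega)) (hc j).1.2
  · rw [Finset.sum_range_succ, hcN, one_mul] at h1
    rw [eq_neg_of_add_eq_zero_right h1, ← Finset.sum_neg_distrib]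
    refine Finset.sum_congr rfl fun j _ => ?_
    rw [NegMemClass.coe_neg, neg_mul]

/-- Homogeneous elements of positive degree, integral over `R`, are nilpotent modulo the maximal
ideal of `R`. -/
theorem mem_radical_map_gradedMaximalIdeal {R : Subalgebra k (PolyRing k V)}
    (hR : IsGradedSubalgebra (polyGrading k V) R) {C : Type u} [CommRing C]
    (g : R →+* C) (ι : C →+* PolyRing k V) (hι : Function.Injective ι) (hg : ∀ r, ι (g r) = r)
    {e : ℕ} (he : e ≠ 0) {c : C}
    (hx : ι c ∈ polyGrading k V e) (hint : IsIntegral R (ι c)) :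
    c ∈ ((gradedMaximalIdeal (polyGrading k V) R).map g).radical := by
  obtain ⟨N, r, hr, h⟩ := exists_pow_eq_sum_of_isIntegral hR he hx hint
  refine ⟨N, ?_⟩
  have : c ^ N = ∑ j ∈ Finset.range N, g (r j) * c ^ j := by
    apply hι
    simp only [map_pow, map_sum, map_mul, hg, h]
  rw [this]
  exact Ideal.sum_mem _ fun j hj => Ideal.mul_mem_right _ _
    (Ideal.mem_map_of_mem g (hr j (Finset.mem_range.1 hj)))

/-- The polynomial ring has depth at least `n` at the ideal of its variables. The variables have
degree 1 and are integral over `R`, so they are nilpotent modulo the extension of its maximal ideal,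
and change of rings applies. -/
theorem finrank_le_gradedDepth {R : Subalgebra k (PolyRing k V)}
    (hR : IsGradedSubalgebra (polyGrading k V) R) (hfin : Module.Finite R (PolyRing k V)) :
    (Module.finrank k V : ℕ∞) ≤ gradedDepth (polyGrading k V) R (ModuleCat.of R (PolyRing k V)) := by
  refine le_depthAt_mvPolynomial.trans (depthAt_le_of_semilinear
    (C := PolyRing k V) (polyRingEquiv k V).symm.toRingEquiv.toRingHom (algebraMap R (PolyRing k V))
    (idealOfVars_fg _ _) ?_ (Z := ModuleCat.of _ (PolyRing k V))
    (polyRingEquiv k V).symm.toAddEquiv ?_ (AddEquiv.refl _) ?_)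
  · rw [Ideal.map_span, Ideal.span_le]
    rintro _ ⟨_, ⟨i, rfl⟩, rfl⟩
    refine mem_radical_map_gradedMaximalIdeal hR (algebraMap R (PolyRing k V)) (RingHom.id _)
      Function.injective_id (fun r => rfl) one_ne_zero ?_ (Algebra.IsIntegral.isIntegral _)
    rw [polyGrading, pow_one]
    exact ⟨_, (SymmetricAlgebra.equivMvPolynomial_symm_X _ i).symm⟩
  · intro a x
    exact map_mul (polyRingEquiv k V).symm a x
  · intro a x
    exact Algebra.smul_def a x

end PolyRing

/-! ### Invariants and an equivariant complement -/

section InvariantSubalgebra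

variable {k : Type u} [Field k] {S : Type u} [CommRing S] [Algebra k S] {G : Type u} [Group G]

/-- The subalgebra of the elements fixed by a group of algebra automorphisms. -/
def invariantSubalgebra (α : G →* (S →ₐ[k] S)) : Subalgebra k S :=
  ⨅ g, AlgHom.equalizer (α g) (AlgHom.id k S)

theorem mem_invariantSubalgebra {α : G →* (S →ₐ[k] S)} {s : S} :
    s ∈ invariantSubalgebra α ↔ ∀ g, α g s = s := by
  rw [invariantSubalgebra, Algebra.mem_iInf]
  rfl

end InvariantSubalgebra

section InvariantSubmodule

variable {k : Type u} [Field k] {S : Type u} [CommRing S] [Algebra k S] {P : Type u} [Group P]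
  {M : Type u} [AddCommGroup M] [Module k M]

/-- Depth of `Ext^j_{kP}(M, S)` in terms of an equivariant complement `U` of the ideal of `S`
generated by invariants `y 0, …, y (m - 1)`. -/
theorem depthAt_extKG_invRep_add_le (σ : Representation k P M) (j : ℕ) (α : P →* (S →ₐ[k] S))
    {Z C : Subalgebra k S} (hZ : ∀ g, ∀ r ∈ Z, α g r = r) (hC : ∀ g, ∀ r ∈ C, α g r = r)
    (U : Submodule Z S) (hU : ∀ g, ∀ u ∈ U, α g u ∈ U) (f : Z →+* C) (hf : ∀ a, (f a : S) = a)
    {I : Ideal Z} (hI : I.FG) {J : Ideal C} (hIJ : I.map f ≤ J) {m : ℕ} (y : Fin m → C)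
    (hyJ : ∀ i, y i ∈ J)
    (ψ : Fin m → S →ₗ[k] S) (hψG : ∀ i g x, ψ i (α g x) = α g (ψ i x))
    (hψ : ∀ i x, ψ i (y i * x) = x) (hψ' : ∀ i l x, i ≠ l → ψ i (y l * x) = y l * ψ i x)
    (q : S →ₗ[k] U) (hqG : ∀ g x, (q (α g x) : S) = α g (q x))
    (hqf : ∀ (a : Z) x, (q (a * x) : S) = a * q x) (hqs : ∀ x : U, q x = x)
    (hqy : ∀ i x, q (y i * x) = 0)
    (χ : Fin m → S →ₗ[k] S) (hχG : ∀ i g x, χ i (α g x) = α g (χ i x))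
    (hχ : ∀ x, x = q x + ∑ i, y i * χ i x) :
    (m : ℕ∞) + depthAt I (extKG σ (invSubRep α Z hZ U hU) j) ≤
      depthAt J (extKG σ (invRep α C hC) j) :=
  depthAt_extKG_add_le (X := S) (X' := U) (ρ := invRep α C hC) (ρ' := invSubRep α Z hZ U hU)
    σ j f hI hIJ y hyJ ψ hψG hψ hψ' q (fun g x => Subtype.ext (hqG g x))
    (fun a x => Subtype.ext ((congrArg (fun b : S => (q (b * x) : S)) (hf a)).trans (hqf a x)))
    (U.subtype.restrictScalars k) (fun _ _ => rfl) hqs hqy χ hχG hχ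

end InvariantSubmodule

/-! ### Operators and depth from a splitting `k[y] ⊗ U ≅ k[V]` -/

namespace PolySplitting

open MvPolynomial TensorProduct

variable {k : Type u} [Field k] {V : Type u} [AddCommGroup V] [Module k V]
  {P : Type u} [Group P] {ρ : Representation k P V} (D : PolySplitting ρ)

theorem polyAction_aeval_mul (g : P) (p : MvPolynomial (Fin (Module.finrank k ρ.invariants)) k)
    (u : D.U) : polyAction ρ g (aeval D.y p * u) = aeval D.y p * (D.URep g u : D.U) := by
  have h : (polyAction ρ g).comp (aeval D.y) = aeval D.y :=
    MvPolynomial.algHom_ext fun i => by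
      rw [AlgHom.comp_apply, aeval_X, D.y_invariant]
  rw [map_mul]
  exact congrArg (· * _) (AlgHom.congr_fun h p)

section

variable [Module.Finite k V]

/-- After restriction to `V^P`, the `m` elements generate an algebra over which `k[V^P]`, of
transcendence degree `m`, is finite. They therefore form a transcendence basis, and independence
lifts back to `k[V]`. -/
theorem algebraicIndependent_y : AlgebraicIndependent k D.y := by
  let W := ρ.invariants
  let r := polyRestrict W
  let y' := fun i => r (D.y i)
  let B := Algebra.adjoin k (Set.range D.y)
  let B' := Algebra.adjoin k (Set.range y')
  let f : B →ₐ[k] PolyRing k W := r.comp B.val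
  have hf (b : B) : f b ∈ B' := by
    have h : Set.range y' = r '' Set.range D.y := Set.range_comp r D.y
    change f b ∈ Algebra.adjoin k (Set.range y')
    rw [h, ← AlgHom.map_adjoin]
    exact ⟨b, b.2, rfl⟩
  let g : B →ₐ[k] B' := f.codRestrict B' hf
  have : IsDomain (PolyRing k W) := (polyRingEquiv k W).toMulEquiv.isDomain _
  have halg : Algebra.IsAlgebraic B' (PolyRing k W) := by
    refine ⟨fun x => IsIntegral.isAlgebraic ?_⟩
    obtain ⟨p, hp, hpx⟩ := D.y_finite.to_isIntegral x
    refine ⟨p.map g.toRingHom, hp.map _, ?_⟩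
    rw [Polynomial.eval₂_map]
    exact hpx
  have hy' : AlgebraicIndependent k y' := by
    refine (Algebra.IsAlgebraic.isTranscendenceBasis_of_lift_le_trdeg_of_finite k y' ?_).1
    rw [(polyRingEquiv k W).trdeg_eq, MvPolynomial.trdeg_of_isDomain]
    simp [W]
  exact hy'.of_comp r

/-- In degree 0, `y i` would be a scalar and so not transcendental. -/
theorem exists_mem_polyGrading_y (i : Fin (Module.finrank k ρ.invariants)) :
    ∃ d ≠ 0, D.y i ∈ polyGrading k V d := by
  obtain ⟨d, hd⟩ := D.y_homogeneous i
  refine ⟨d, ?_, hd⟩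
  rintro rfl
  obtain ⟨c, hc⟩ := mem_polyGrading_zero_iff.1 hd
  refine D.algebraicIndependent_y.transcendental i ?_
  rw [← hc]
  exact isAlgebraic_algebraMap c

/-- The isomorphism `k[y_1, …, y_m] ⊗ U ≅ k[V]`. -/
def tensorEquiv : MvPolynomial (Fin (Module.finrank k ρ.invariants)) k ⊗[k] D.U ≃ₗ[k] PolyRing k V :=
  (TensorProduct.congr D.algebraicIndependent_y.aevalEquiv.toLinearEquiv
    (LinearEquiv.refl k D.U)).trans (LinearEquiv.ofBijective _ D.mul_bijective)

theorem tensorEquiv_tmul (p : MvPolynomial (Fin (Module.finrank k ρ.invariants)) k) (u : D.U) :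
    D.tensorEquiv (p ⊗ₜ u) = aeval D.y p * u := by
  change ((D.algebraicIndependent_y.aevalEquiv p : Algebra.adjoin k (Set.range D.y)) : PolyRing k V)
    * (u : PolyRing k V) = _
  exact congrArg (· * _) (D.algebraicIndependent_y.algebraMap_aevalEquiv p)

theorem tensorEquiv_symm_mul (p : MvPolynomial (Fin (Module.finrank k ρ.invariants)) k) (u : D.U) :
    D.tensorEquiv.symm (aeval D.y p * u) = p ⊗ₜ u := by
  rw [← tensorEquiv_tmul, LinearEquiv.symm_apply_apply]

theorem linearMap_ext {N : Type*} [AddCommMonoid N] [Module k N] {f g : PolyRing k V →ₗ[k] N}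
    (h : ∀ (p : MvPolynomial (Fin (Module.finrank k ρ.invariants)) k) (u : D.U),
      f (aeval D.y p * u) = g (aeval D.y p * u)) (x : PolyRing k V) : f x = g x := by
  have : f ∘ₗ D.tensorEquiv.toLinearMap = g ∘ₗ D.tensorEquiv.toLinearMap :=
    TensorProduct.ext' fun p u => by
      change f (D.tensorEquiv _) = g (D.tensorEquiv _)
      rw [tensorEquiv_tmul, h]
  have h1 := LinearMap.congr_fun this (D.tensorEquiv.symm x)
  change f (D.tensorEquiv _) = g (D.tensorEquiv _) at h1
  rwa [LinearEquiv.apply_symm_apply] at h1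

/-- The endomorphism of `k[V]` induced by an endomorphism of `k[y_1, …, y_m]`. -/
def extend (F : MvPolynomial (Fin (Module.finrank k ρ.invariants)) k →ₗ[k]
      MvPolynomial (Fin (Module.finrank k ρ.invariants)) k) : PolyRing k V →ₗ[k] PolyRing k V :=
  D.tensorEquiv.toLinearMap ∘ₗ F.rTensor D.U ∘ₗ D.tensorEquiv.symm.toLinearMap

theorem extend_mul (F) (p : MvPolynomial (Fin (Module.finrank k ρ.invariants)) k) (u : D.U) :
    D.extend F (aeval D.y p * u) = aeval D.y (F p) * u := by
  change D.tensorEquiv (F.rTensor D.U (D.tensorEquiv.symm _)) = _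
  rw [tensorEquiv_symm_mul, LinearMap.rTensor_tmul, tensorEquiv_tmul]

/-- The projection `k[V] → U` that sets `y_1, …, y_m` to zero. -/
def toU : PolyRing k V →ₗ[k] D.U :=
  (TensorProduct.lid k D.U).toLinearMap ∘ₗ
    LinearMap.rTensor D.U (aeval (R := k) (0 : Fin (Module.finrank k ρ.invariants) → k)).toLinearMap
    ∘ₗ D.tensorEquiv.symm.toLinearMap

theorem toU_mul (p : MvPolynomial (Fin (Module.finrank k ρ.invariants)) k) (u : D.U) :
    D.toU (aeval D.y p * u) = constantCoeff p • u := by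
  change TensorProduct.lid k D.U (LinearMap.rTensor D.U _ (D.tensorEquiv.symm _)) = _
  rw [tensorEquiv_symm_mul, LinearMap.rTensor_tmul, TensorProduct.lid_tmul]
  change (aeval (R := k) (0 : Fin (Module.finrank k ρ.invariants) → k)) p • u = _
  rw [aeval_zero]
  rfl

/-- `P` fixes every `y_i`, so it acts only on the factor `U`, whereas the extended operator acts
only on `k[y]`. -/
theorem extend_polyAction (F) (g : P) (x : PolyRing k V) :
    D.extend F (polyAction ρ g x) = polyAction ρ g (D.extend F x) := by
  refine D.linearMap_ext (f := D.extend F ∘ₗ (polyAction ρ g).toLinearMap)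
    (g := (polyAction ρ g).toLinearMap ∘ₗ D.extend F) (fun p u => ?_) x
  change D.extend F (polyAction ρ g _) = polyAction ρ g (D.extend F _)
  rw [polyAction_aeval_mul, extend_mul, extend_mul, polyAction_aeval_mul]

theorem toU_polyAction (g : P) (x : PolyRing k V) :
    D.toU (polyAction ρ g x) = D.URep g (D.toU x) := by
  let τ : D.U →ₗ[k] D.U := (D.URep g).restrictScalars k
  refine D.linearMap_ext (f := D.toU ∘ₗ (polyAction ρ g).toLinearMap)
    (g := τ ∘ₗ D.toU) (fun p u => ?_) x
  change D.toU (polyAction ρ g _) = τ (D.toU _)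
  rw [polyAction_aeval_mul, toU_mul, toU_mul, map_smul]
  rfl

set_option synthInstance.maxHeartbeats 200000 in
theorem toU_smul (a : D.kz) (x : PolyRing k V) : D.toU (a * x) = a • D.toU x := by
  refine D.linearMap_ext (f := D.toU ∘ₗ LinearMap.mulLeft k (a : PolyRing k V))
    (g := (LinearMap.lsmul D.kz D.U a).restrictScalars k ∘ₗ D.toU) (fun p u => ?_) x
  change D.toU (a * (aeval D.y p * u)) = a • D.toU (aeval D.y p * u)
  have : (a * (aeval D.y p * u) : PolyRing k V) = aeval D.y p * (a • u : D.U) :=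
    mul_left_comm _ _ _
  rw [this, toU_mul, toU_mul, smul_comm]

theorem toU_coe (u : D.U) : D.toU u = u := by
  have h := D.toU_mul 1 u
  rwa [map_one, one_mul, map_one, one_smul] at h

theorem toU_y_mul (i) (x : PolyRing k V) : D.toU (D.y i * x) = 0 := by
  refine D.linearMap_ext (f := D.toU ∘ₗ LinearMap.mulLeft k (D.y i)) (g := 0) (fun p u => ?_) x
  change D.toU (D.y i * (aeval D.y p * u)) = 0
  have : D.y i * (aeval D.y p * u) = aeval D.y (X i * p) * u := by
    rw [map_mul, aeval_X, mul_assoc]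
  rw [this, toU_mul, map_mul, constantCoeff_X, zero_mul, zero_smul]

theorem extend_divX_y_mul (i) (x : PolyRing k V) : D.extend (divX k i) (D.y i * x) = x := by
  refine D.linearMap_ext (f := D.extend (divX k i) ∘ₗ LinearMap.mulLeft k (D.y i))
    (g := LinearMap.id) (fun p u => ?_) x
  change D.extend (divX k i) (D.y i * (aeval D.y p * u)) = aeval D.y p * u
  have : D.y i * (aeval D.y p * u) = aeval D.y (X i * p) * u := by
    rw [map_mul, aeval_X, mul_assoc]
  rw [this, extend_mul, divX_X_mul]

theorem extend_divX_y_mul_of_ne {i l} (h : i ≠ l) (x : PolyRing k V) :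
    D.extend (divX k i) (D.y l * x) = D.y l * D.extend (divX k i) x := by
  refine D.linearMap_ext (f := D.extend (divX k i) ∘ₗ LinearMap.mulLeft k (D.y l))
    (g := LinearMap.mulLeft k (D.y l) ∘ₗ D.extend (divX k i)) (fun p u => ?_) x
  change D.extend (divX k i) (D.y l * (aeval D.y p * u))
    = D.y l * D.extend (divX k i) (aeval D.y p * u)
  have (q : MvPolynomial _ k) : D.y l * (aeval D.y q * u) = aeval D.y (X l * q) * u := by
    rw [map_mul, aeval_X, mul_assoc]
  rw [this, extend_mul, extend_mul, divX_X_mul_of_ne h, this]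

theorem eq_toU_add_sum {χ : Fin (Module.finrank k ρ.invariants) →
      MvPolynomial (Fin (Module.finrank k ρ.invariants)) k →ₗ[k]
        MvPolynomial (Fin (Module.finrank k ρ.invariants)) k}
    (hχ : ∀ p, p = C (constantCoeff p) + ∑ i, X i * χ i p) (x : PolyRing k V) :
    x = D.toU x + ∑ i, D.y i * D.extend (χ i) x := by
  let s : D.U →ₗ[k] PolyRing k V := D.U.subtype.restrictScalars k
  have h := D.linearMap_ext (f := LinearMap.id)
    (g := s ∘ₗ D.toU + ∑ i, LinearMap.mulLeft k (D.y i) ∘ₗ D.extend (χ i)) (fun p u => ?_) x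
  · rw [LinearMap.add_apply, LinearMap.sum_apply] at h
    exact h
  · rw [LinearMap.add_apply, LinearMap.sum_apply]
    change aeval D.y p * u = s (D.toU (aeval D.y p * u))
      + ∑ i, D.y i * D.extend (χ i) (aeval D.y p * u)
    simp only [toU_mul, extend_mul]
    rw [map_smul]
    nth_rw 1 [hχ p]
    rw [map_add, add_mul, map_sum, Finset.sum_mul, aeval_C, ← Algebra.smul_def]
    simp only [map_mul, aeval_X, mul_assoc]
    rfl

theorem add_depthAt_extKG_le {M : Type u} [AddCommGroup M] [Module k M]
    (σ : Representation k P M) {C : Subalgebra k (PolyRing k V)}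
    (hC : ∀ g, ∀ c ∈ C, polyAction ρ g c = c) (f : D.kz →+* C)
    (hf : ∀ a, (f a : PolyRing k V) = a) {I : Ideal D.kz} (hI : I.FG) {J : Ideal C}
    (hIJ : I.map f ≤ J) (y : Fin (Module.finrank k ρ.invariants) → C)
    (hy : ∀ i, (y i : PolyRing k V) = D.y i) (hyJ : ∀ i, y i ∈ J) (j : ℕ) :
    (Module.finrank k ρ.invariants : ℕ∞) + depthAt I (extKG (X := D.U) σ D.URep j) ≤
      depthAt J (extKG σ (invRep (polyAction ρ) C hC) j) := by
  obtain ⟨χ, hχ⟩ := exists_linearMap_sub_constantCoeff k (Module.finrank k ρ.invariants)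
  refine depthAt_extKG_invRep_add_le σ j (polyAction ρ) D.kz_invariant hC D.U D.U_stable f hf hI hIJ
    y hyJ (fun i => D.extend (divX k i)) (fun i => D.extend_polyAction _) (fun i x => ?_)
    (fun i l x h => ?_) D.toU (fun g x => congrArg Subtype.val (D.toU_polyAction g x))
    (fun a x => congrArg Subtype.val (D.toU_smul a x)) D.toU_coe (fun i x => ?_)
    (fun i => D.extend (χ i)) (fun i => D.extend_polyAction _) (fun x => ?_)
  · rw [hy]
    exact D.extend_divX_y_mul i x
  · rw [hy]
    exact D.extend_divX_y_mul_of_ne h x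
  · rw [hy]
    exact D.toU_y_mul i x
  · simp only [hy]
    exact D.eq_toU_add_sum hχ x

/-- The `y_i` and `z_i` need not lie in `R`, so the comparison runs through `C = k[V]^P`, which
contains `R` as well as `k[z]` and the `y_i`. The regular sequence gives the bound over `C`, and
change of rings passes it to `R`. -/
theorem add_gradedDepth_extKG_le {M : Type u} [AddCommGroup M] [Module k M]
    (σ : Representation k P M) {R : Subalgebra k (PolyRing k V)}
    (hR : ∀ g, ∀ r ∈ R, polyAction ρ g r = r) (hRg : IsGradedSubalgebra (polyGrading k V) R)
    (hfin : Module.Finite R (PolyRing k V)) (j : ℕ) :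
    (Module.finrank k ρ.invariants : ℕ∞) + gradedDepth (polyGrading k V) D.kz (extKG (X := D.U) σ D.URep j) ≤
      gradedDepth (polyGrading k V) R (extKG σ (invRep (polyAction ρ) R hR) j) := by
  let C := invariantSubalgebra (polyAction ρ)
  have hC (g : P) (c : PolyRing k V) (hc : c ∈ C) : polyAction ρ g c = c :=
    mem_invariantSubalgebra.1 hc g
  let f : D.kz →+* C :=
    (Subalgebra.inclusion fun _ h => mem_invariantSubalgebra.2 fun g => D.kz_invariant g _ h).toRingHom
  let g : R →+* C :=
    (Subalgebra.inclusion fun _ h => mem_invariantSubalgebra.2 fun g => hR g _ h).toRingHom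
  let y (i) : C := ⟨D.y i, mem_invariantSubalgebra.2 fun g => D.y_invariant g i⟩
  have hkz : IsNoetherianRing D.kz :=
    have : Algebra.FiniteType k D.kz :=
      (Subalgebra.fg_iff_finiteType _).1 (Subalgebra.fg_def.2 ⟨_, Set.finite_range D.z, rfl⟩)
    Algebra.FiniteType.isNoetherianRing k D.kz
  let I := gradedMaximalIdeal (polyGrading k V) D.kz
  have hI : I.FG := IsNoetherian.noetherian I
  -- `J` has to contain the regular sequence and the extension of the maximal ideal of `k[z]`. It is
  -- finitely generated because `k[z]` is noetherian, and it lies in the radical of the extended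
  -- ideal of `R` because its generators can be taken homogeneous of positive degree.
  let J : Ideal C := Ideal.span (Set.range y) ⊔ I.map f
  have hJ : J.FG := Submodule.FG.sup (Submodule.fg_span (Set.finite_range y)) (hI.map f)
  have hJR : J ≤ ((gradedMaximalIdeal (polyGrading k V) R).map g).radical := by
    have key {e : ℕ} (he : e ≠ 0) {c : C} (hc : (c : PolyRing k V) ∈ polyGrading k V e) :
        c ∈ ((gradedMaximalIdeal (polyGrading k V) R).map g).radical :=
      mem_radical_map_gradedMaximalIdeal hRg g C.val.toRingHom Subtype.val_injective
        (fun _ => rfl) he hc (Algebra.IsIntegral.isIntegral _)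
    refine sup_le (Ideal.span_le.2 ?_) (Ideal.map_le_iff_le_comap.2 ?_)
    · rintro _ ⟨i, rfl⟩
      obtain ⟨d, hd, hy⟩ := D.exists_mem_polyGrading_y i
      exact key hd hy
    · refine (gradedMaximalIdeal_le_span _).trans (Ideal.span_le.2 ?_)
      rintro r ⟨d, hd, hr⟩
      exact key (c := f r) hd hr
  have h1 := D.add_depthAt_extKG_le σ hC f (fun _ => rfl) hI (le_sup_right : I.map f ≤ J) y
    (fun _ => rfl) (fun i => Ideal.mem_sup_left (Ideal.subset_span ⟨i, rfl⟩)) j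
  exact h1.trans (depthAt_extKG_le_of_semilinear σ j g hJ hJR (LinearEquiv.refl k _)
    (fun _ _ => rfl) (fun _ _ => rfl))

end

end PolySplitting

end

/-! ### Assembly of the two parts -/

theorem theorem5p4 {k : Type u} [Field k] {G : Type u} [Group G] [Finite G]
    {M : Type u} [AddCommGroup M] [Module k M] [Module.Finite k M] (σ : Representation k G M) :
    -- a graded `k`-algebra `S` with an action of `G`, and a graded local `R ≤ S^G`
    (∀ (S : Type u) [CommRing S] [Algebra k S] (𝒜 : ℤ → Submodule k S) [GradedAlgebra 𝒜]
      (α : G →* (S →ₐ[k] S)) (_ : ∀ g i, ∀ s ∈ 𝒜 i, α g s ∈ 𝒜 i)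
      (R : Subalgebra k S) (hR : ∀ g, ∀ r ∈ R, α g r = r)
      (_ : IsGradedSubalgebra 𝒜 R) (_ : IsGradedLocal 𝒜 R),
      min (gradedDepth 𝒜 R (ModuleCat.of R S))
          (⨅ (j : ℕ) (_ : 1 ≤ j), gradedDepth 𝒜 R (extKG σ (invRep α R hR) j) + j + 1)
        ≤ gradedDepth 𝒜 R (homKG σ (invRep α R hR)))
    ∧
    -- `S = k[V]`, finite over the graded subalgebra `R ≤ k[V]^G`
    (∀ (V : Type u) [AddCommGroup V] [Module k V] [Module.Finite k V] (ρ : Representation k G V)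
      (P : Subgroup G) (_ : IsRelativelyProjective σ P)
      (D : PolySplitting (ρ.comp P.subtype))
      (R : Subalgebra k (PolyRing k V)) (hR : ∀ g, ∀ r ∈ R, polyAction ρ g r = r)
      (_ : IsGradedSubalgebra (polyGrading k V) R) (_ : Module.Finite R (PolyRing k V)),
      min (Module.finrank k V : ℕ∞)
          (Module.finrank k (Representation.invariants (ρ.comp P.subtype)) +
            ⨅ (j : ℕ) (_ : 1 ≤ j),
              gradedDepth (polyGrading k V) D.kz (extKG (X := D.U) (σ.comp P.subtype) D.URep j) + j + 1)
        ≤ gradedDepth (polyGrading k V) R (homKG σ (invRep (polyAction ρ) R hR))) := by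
  refine ⟨fun S _ _ 𝒜 _ α _ R hR _ _ =>
    min_depthAt_le_depthAt_homKG σ (invRep α R hR) (gradedMaximalIdeal 𝒜 R), ?_⟩
  intro V _ _ _ ρ P hP D R hR hRg hfin
  -- Relative projectivity replaces `G` by `P`, after which the general bound is applied to `P`
  -- acting on `k[V]` and estimated term by term.
  refine le_trans ?_ (depthAt_homKG_subgroup_le hP (invRep (polyAction ρ) R hR)
    (gradedMaximalIdeal (polyGrading k V) R))
  refine le_trans ?_ (min_depthAt_le_depthAt_homKG (σ.comp P.subtype)
    ((invRep (polyAction ρ) R hR).comp P.subtype) (gradedMaximalIdeal (polyGrading k V) R))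
  refine min_le_min (finrank_le_gradedDepth hRg hfin) (le_iInf₂ fun j hj => ?_)
  refine (add_le_add_right (iInf₂_le j hj) _).trans ?_
  rw [← add_assoc, ← add_assoc]
  exact add_le_add_left (add_le_add_left (D.add_gradedDepth_extKG_le (σ.comp P.subtype)
    (fun g r hr => hR g r hr) hRg hfin j) _) _
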